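/- **Theorem.** Let $\Theta\subset\mathbb R^p$ be a nonempty connected open set. For each $\theta\in\Theta$ let $K_\theta\in\mathbb R^{m\times n}$, let $g_\theta:\mathbb R^n\to\mathbb R\cup\{+\infty\}$ be closed, proper and $\alpha$-strongly convex, and let $f_\theta:\mathbb R^m\to\mathbb R\cup\{+\infty\}$ be closed, proper and convex with $\alpha$-strongly convex conjugate $f_\theta^*$, where $\alpha>0$ does not depend on $\theta$. Let $\beta>0$ with $\|K_\theta\|_{\mathrm{op}}\le\beta$ for all $\theta\in\Theta$. Consider the problem $$\min_{x\in\mathbb R^n}\; g_\theta(x)+\max_{y\in\mathbb R^m}\;\langle K_\theta x,y\rangle-f_\theta^*(y),$$ a solution of which is a pair $(x,y)$ such that $x$ minimizes the outer objective and $y$ attains the inner maximum at $x$. Definitions. On an open set $U$, a map $F$ is *path differentiable* if it is locally Lipschitz and admits a *conservative Jacobian*, i.e. a set-valued map $\mathcal J$ from $U$ to matrices that is nonempty valued, locally bounded, graph closed, and such that for every absolutely continuous curve $c:[0,1]\to U$ one has, for almost every $t\in[0,1]$, $\frac{d}{dt}F(c(t))=A\,\dot c(t)$ for all $A\in\mathcal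 J(c(t))$. The *Clarke Jacobian* $\mathrm{Jac}^c_F(x)$ is the convex hull of all limits of Jacobians of $F$ along sequences of differentiability points of $F$ converging to $x$. Further, $\mathrm{prox}_h(x)=\mathrm{argmin}_u\, h(u)+\frac12\|x-u\|^2$. Assume that $(\theta,x)\mapsto\mathrm{prox}_{g_\theta}(x)$, $(\theta,y)\mapsto\mathrm{prox}_{f_\theta}(y)$ and $\theta\mapsto K_\theta$ are path differentiable on $\Theta\times\mathbb R^n$, $\Theta\times\mathbb R^m$ and $\Theta$, and let $\gamma\in\left(0,\frac{2\alpha}{(\alpha+\beta)^2}\right)$. Then for each $\theta\in\Theta$ the problem has exactly one solution $(x^\star(\theta),y^\star(\theta))$, and the map $(x^\star,y^\star)$ is path differentiable on $\Theta$. Write $P^g(\theta,x)=\mathrm{prox}_{\gamma g_\theta}(x)$, $P^{f^*}(\theta,y)=\mathrm{prox}_{\gamma f^*_\theta}(y)$ and $B(\theta,x,y)=(K_\theta^*y,-K_\theta x)$. Then $(x^\star,y^\star)$ admits the conservative Jacobian $$\theta\rightrightarrows\left\{-S^{-1}R\;:\;[R\ \ S]\in\mathcal J(\theta)\right\},$$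 where $\mathcal J(\theta)$ is the set of all $[R\ \ S]$ with $$R=\gamma\begin{bmatrix}V_1&0\\0&V_2\end{bmatrix}W-\begin{bmatrix}U_1\\U_2\end{bmatrix},\qquad S=\begin{bmatrix}\mathrm{Id}_n-V_1&-V_1(-\gamma K_\theta^*)\\-V_2(\gamma K_\theta)&\mathrm{Id}_m-V_2\end{bmatrix},$$ $$[U_1\ V_1]\in\mathrm{Jac}^c_{P^g}(\theta,x^\star(\theta)-\gamma K_\theta^*y^\star(\theta)),\quad [U_2\ V_2]\in\mathrm{Jac}^c_{P^{f^*}}(\theta,y^\star(\theta)+\gamma K_\theta x^\star(\theta)),\quad [W\ Z]\in\mathrm{Jac}^c_{B}(\theta,x^\star(\theta),y^\star(\theta)),$$ and every such $S$ is invertible. The same conclusions (invertibility and conservativity) hold with $\mathcal J(\theta)$ replaced by the set of all $[\gamma VW-U\ \ \ \mathrm{Id}_{n+m}-V(\mathrm{Id}_{n+m}-\gamma Z)]$ with $[U\ V]\in\mathrm{Jac}^c_T(\theta,x^\star(\theta)-\gamma K_\theta^*y^\star(\theta),y^\star(\theta)+\gamma K_\theta x^\star(\theta))$ and $[W\ Z]\in\mathrm{Jac}^c_B(\theta,x^\star(\theta),y^\star(\theta))$,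 where $T(\theta,x,y)=(P^g(\theta,x),P^{f^*}(\theta,y))$. -/

import Mathlib

open scoped Topology InnerProductSpace

noncomputable section

/-! ### Conservative calculus -/

section Conservative

variable {E F : Type*} [NormedAddCommGroup E] [NormedSpace ℝ E]
  [NormedAddCommGroup F] [NormedSpace ℝ F]

/-- The Clarke Jacobian of `f` at `x`: the convex hull of all limits of Jacobians of `f` along
sequences of differentiability points of `f` that converge to `x`. If `f` is only of interest on
an open set `U` and `x ∈ U`, the values of `f` outside `U` play no role. -/
def clarkeJacobian (f : E → F) (x : E) : Set (E →L[ℝ] F) :=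
  convexHull ℝ {A | ∃ u : ℕ → E, (∀ k, DifferentiableAt ℝ f (u k)) ∧
    Filter.Tendsto u Filter.atTop (𝓝 x) ∧
    Filter.Tendsto (fun k => fderiv ℝ f (u k)) Filter.atTop (𝓝 A)}

/-- The set-valued map `J` is a conservative Jacobian on the open set `U` for the (locally
Lipschitz) map `f`: nonempty valued, locally bounded, with closed graph (relative to `U`), and with
the chain rule along all absolutely continuous curves `c : [0,1] → U`. -/
structure IsConservativeJacobianOn (U : Set E) (f : E → F) (J : E → Set (E →L[ℝ] F)) : Prop where
  nonempty : ∀ x ∈ U, (J x).Nonempty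
  locallyBounded : ∀ x ∈ U, ∃ C : ℝ, ∃ N ∈ 𝓝 x, ∀ x' ∈ N ∩ U, ∀ A ∈ J x', ‖A‖ ≤ C
  closedGraph : ∀ x ∈ U, ∀ A : E →L[ℝ] F,
    (x, A) ∈ closure {q : E × (E →L[ℝ] F) | q.1 ∈ U ∧ q.2 ∈ J q.1} → A ∈ J x
  chainRule : ∀ c : ℝ → E, AbsolutelyContinuousOnInterval c 0 1 →
    (∀ t ∈ Set.Icc (0 : ℝ) 1, c t ∈ U) →
    ∀ᵐ t ∂(MeasureTheory.volume.restrict (Set.Icc (0 : ℝ) 1)),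
      ∀ A ∈ J (c t), HasDerivAt (fun s => f (c s)) (A (deriv c t)) t

/-- Path differentiability on the open set `U`: locally Lipschitz, with some conservative
Jacobian. -/
def PathDifferentiableOn (U : Set E) (f : E → F) : Prop :=
  LocallyLipschitzOn U f ∧ ∃ J : E → Set (E →L[ℝ] F), IsConservativeJacobianOn U f J

end Conservative

/-! ### Convex analysis for extended-real-valued functions -/

section Convex

variable {E : Type*} [NormedAddCommGroup E] [InnerProductSpace ℝ E]

/-- Properness: never `-∞`, and not identically `+∞`. -/
def ProperFun (h : E → EReal) : Prop :=
  (∀ x, h x ≠ ⊥) ∧ ∃ x, h x ≠ ⊤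

/-- `μ`-strong convexity of an extended-real-valued function; `μ = 0` is convexity. -/
def StronglyConvexFun (μ : ℝ) (h : E → EReal) : Prop :=
  ∀ x y : E, ∀ a b : ℝ, 0 < a → 0 < b → a + b = 1 →
    h (a • x + b • y) + ((μ / 2 * (a * b) * ‖x - y‖ ^ 2 : ℝ) : EReal)
      ≤ (a : EReal) * h x + (b : EReal) * h y

/-- The Fenchel conjugate `h*(y) = sup_x ⟨x, y⟩ - h(x)`. -/
def fenchelConj (h : E → EReal) (y : E) : EReal :=
  ⨆ x : E, ((⟪x, y⟫_ℝ : ℝ) : EReal) - h x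

/-- The proximal operator: `prox h x` is the minimizer of `u ↦ h(u) + ‖x - u‖² / 2` (it exists and
is unique for closed convex proper functions on a finite-dimensional space). -/
def prox (h : E → EReal) (x : E) : E :=
  Classical.epsilon fun u : E => ∀ v : E,
    h u + ((1 / 2 * ‖x - u‖ ^ 2 : ℝ) : EReal) ≤ h v + ((1 / 2 * ‖x - v‖ ^ 2 : ℝ) : EReal)

end Convex

/-! ### The primal-dual problem -/

section PrimalDual

variable {P X Y : Type*} [NormedAddCommGroup P] [NormedSpace ℝ P]
  [NormedAddCommGroup X] [InnerProductSpace ℝ X] [NormedAddCommGroup Y] [InnerProductSpace ℝ Y]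

/-- `z = (x, y)` solves `min_x g(x) + max_y ⟨K x, y⟩ - fs(y)`: the point `x` minimizes the outer
objective, and `y` attains the inner maximum at `x`. -/
def IsMinMaxSolution (g : X → EReal) (fs : Y → EReal) (K : X →L[ℝ] Y) (z : X × Y) : Prop :=
  (∀ x : X, g z.1 + (⨆ y : Y, ((⟪K z.1, y⟫_ℝ : ℝ) : EReal) - fs y)
      ≤ g x + (⨆ y : Y, ((⟪K x, y⟫_ℝ : ℝ) : EReal) - fs y)) ∧
  ∀ y : Y, ((⟪K z.1, y⟫_ℝ : ℝ) : EReal) - fs y ≤ ((⟪K z.1, z.2⟫_ℝ : ℝ) : EReal) - fs z.2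

/-- The parametric proximal map `(θ, x) ↦ prox_{γ h_θ}(x)`. -/
def proxMap (γ : ℝ) (h : P → X → EReal) (q : P × X) : X :=
  prox (fun u => (γ : EReal) * h q.1 u) q.2

/-- `T(θ, (x, y)) = (prox_{γ g_θ}(x), prox_{γ fs_θ}(y))`, the resolvent of `γ A_θ` for
`A_θ = diag(∂g_θ, ∂fs_θ)`. -/
def backwardMap (γ : ℝ) (g : P → X → EReal) (fs : P → Y → EReal) (q : P × (X × Y)) : X × Y :=
  (proxMap γ g (q.1, q.2.1), proxMap γ fs (q.1, q.2.2))

/-- `B(θ, (x, y)) = (K_θ* y, - K_θ x)`. -/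
def couplingMap [CompleteSpace X] [CompleteSpace Y] (K : P → X →L[ℝ] Y) (q : P × (X × Y)) :
    X × Y :=
  (ContinuousLinearMap.adjoint (K q.1) q.2.2, - K q.1 q.2.1)

/-- The Jacobians `[γ V W - U, Id - V (Id - γ Z)]` of the residual
`res(θ, z) = z - T(θ, z - γ B(θ, z))` at `q = (θ, z)`, where `[U V]` ranges over the Clarke Jacobian
of `T` at `(θ, z - γ B(θ, z))`, and `[W Z]` over that of `B` at `(θ, z)`. -/
def resJacobian {Z : Type*} [NormedAddCommGroup Z] [NormedSpace ℝ Z] (γ : ℝ) (T B : P × Z → Z)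
    (q : P × Z) : Set (P × Z →L[ℝ] Z) :=
  {D | ∃ M ∈ clarkeJacobian T (q.1, q.2 - γ • B q), ∃ N ∈ clarkeJacobian B q,
    let U : P →L[ℝ] Z := M ∘L ContinuousLinearMap.inl ℝ P Z
    let V : Z →L[ℝ] Z := M ∘L ContinuousLinearMap.inr ℝ P Z
    let W : P →L[ℝ] Z := N ∘L ContinuousLinearMap.inl ℝ P Z
    let Z' : Z →L[ℝ] Z := N ∘L ContinuousLinearMap.inr ℝ P Z
    D = (γ • (V ∘L W) - U).coprod
      (ContinuousLinearMap.id ℝ Z - V ∘L (ContinuousLinearMap.id ℝ Z - γ • Z'))}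

/-- The block version of the Jacobians of the residual of the primal-dual problem at
`q = (θ, (x, y))`: `[U₁ V₁]` and `[U₂ V₂]` range independently over the Clarke Jacobians of the two
parametric proximal maps, at `(θ, x - γ K_θ* y)` and at `(θ, y + γ K_θ x)`, and `[W Z]` over the
Clarke Jacobian of `B` at `q`. The elements are `[R S]` with the `θ`-part
`R = γ diag(V₁, V₂) W - (U₁, U₂)` and the `(x, y)`-part
`S = [Id - V₁, - V₁ (- γ K_θ*); - V₂ (γ K_θ), Id - V₂]`. -/
def resJacobianBlock [CompleteSpace X] [CompleteSpace Y] (γ : ℝ) (g : P → X → EReal)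
    (fs : P → Y → EReal) (K : P → X →L[ℝ] Y) (q : P × (X × Y)) :
    Set (P × (X × Y) →L[ℝ] X × Y) :=
  {D | ∃ M₁ ∈ clarkeJacobian (proxMap γ g)
        (q.1, q.2.1 - γ • ContinuousLinearMap.adjoint (K q.1) q.2.2),
      ∃ M₂ ∈ clarkeJacobian (proxMap γ fs) (q.1, q.2.2 + γ • K q.1 q.2.1),
      ∃ N ∈ clarkeJacobian (couplingMap K) q,
    let U₁ : P →L[ℝ] X := M₁ ∘L ContinuousLinearMap.inl ℝ P X
    let V₁ : X →L[ℝ] X := M₁ ∘L ContinuousLinearMap.inr ℝ P X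
    let U₂ : P →L[ℝ] Y := M₂ ∘L ContinuousLinearMap.inl ℝ P Y
    let V₂ : Y →L[ℝ] Y := M₂ ∘L ContinuousLinearMap.inr ℝ P Y
    let W : P →L[ℝ] X × Y := N ∘L ContinuousLinearMap.inl ℝ P (X × Y)
    let W₁ : P →L[ℝ] X := ContinuousLinearMap.fst ℝ X Y ∘L W
    let W₂ : P →L[ℝ] Y := ContinuousLinearMap.snd ℝ X Y ∘L W
    let R : P →L[ℝ] X × Y := (γ • (V₁ ∘L W₁) - U₁).prod (γ • (V₂ ∘L W₂) - U₂)
    let S : X × Y →L[ℝ] X × Y :=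
      ((ContinuousLinearMap.id ℝ X - V₁).coprod
          (-(V₁ ∘L (-(γ • ContinuousLinearMap.adjoint (K q.1)))))).prod
        ((-(V₂ ∘L (γ • K q.1))).coprod (ContinuousLinearMap.id ℝ Y - V₂))
    D = R.coprod S}

/-- The partial Jacobian in the second variable: `V` from `[U V]`. -/
def partialSnd {Z : Type*} [NormedAddCommGroup Z] [NormedSpace ℝ Z] (D : P × Z →L[ℝ] Z) :
    Z →L[ℝ] Z :=
  D ∘L ContinuousLinearMap.inr ℝ P Z

/-- The partial Jacobian in the first variable: `U` from `[U V]`. -/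
def partialFst {Z : Type*} [NormedAddCommGroup Z] [NormedSpace ℝ Z] (D : P × Z →L[ℝ] Z) :
    P →L[ℝ] Z :=
  D ∘L ContinuousLinearMap.inl ℝ P Z

/-- The implicit Jacobians `- V⁻¹ U`, where `[U V]` ranges over `R` (meaningful when all the `V` are
invertible). -/
def implicitJacobian {Z : Type*} [NormedAddCommGroup Z] [NormedSpace ℝ Z]
    (R : Set (P × Z →L[ℝ] Z)) : Set (P →L[ℝ] Z) :=
  {A | ∃ D ∈ R, A = -((partialSnd D).inverse ∘L partialFst D)}

end PrimalDual

end

/-! Solutions are fixed points. The optimality conditions `-K* y ∈ ∂g(x)`, `K x ∈ ∂f*(y)` say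
exactly that `z = T(θ, z - γ B(θ, z))`. By strong convexity, `T` contracts in `z` by `1 / (1 + γα)`
for the Euclidean norm of the product. Since `B` is linear and skew in `z`, the forward step `Id -
γB` has norm at most `√(1 + γ²β²)`. The product of the two factors is below `1` for the given step
sizes (`contraction_factor_lt_one`), so Banach's theorem gives existence; strong convexity gives
uniqueness.

The same estimate controls derivatives. Bounds on increments in `z` pass to Clarke Jacobians
(`norm_clarkeJacobian_apply_inr_le`), so `S k = 0` means `k = V (Id - γZ) k` with a contraction on
the right, and `S` is injective. At the level of the map, the contraction makes the solution locally
Lipschitz (`locallyLipschitzOn_of_implicit`). The solution then sends absolutely continuous curves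
to absolutely continuous curves, and differentiating the residual along `(c, z ∘ c)` gives the
implicit formula (`IsConservativeJacobianOn.implicit`).

Two inputs remain. First, Clarke Jacobians of path differentiable maps are conservative: integrating
along segments bounds the Clarke Jacobian by the support function of any conservative one, whose
elements all agree on the velocity of a curve. Second, the hypotheses concern `prox_g` and `prox_f`
with unit step. Moreau's identity turns `prox_f` into `prox_{f*}`, and `u = prox_{γh}(x)` solves `u
= prox_h(γ⁻¹ x + (1 - γ⁻¹) u)`, to which the implicit theorem applies again
(`PathDifferentiableOn.proxMap`). -/

noncomputable section

/-! ### Sequentially compact set-valued maps -/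

/-- Every sequence in the graph of `J` whose base points converge in `U` has a subsequence that
converges in the graph. -/
def SubseqClosedOn {E A : Type*} [TopologicalSpace E] [TopologicalSpace A] (U : Set E)
    (J : E → Set A) : Prop :=
  ∀ (u : ℕ → E) (a : ℕ → A), (∀ k, u k ∈ U) → (∀ k, a k ∈ J (u k)) → ∀ x ∈ U,
    Filter.Tendsto u Filter.atTop (𝓝 x) →
    ∃ b ∈ J x, ∃ φ : ℕ → ℕ, StrictMono φ ∧ Filter.Tendsto (a ∘ φ) Filter.atTop (𝓝 b)

section

/-- Two successive extractions of subsequences. Every Jacobian built from two others by a continuous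
operation gets its boundedness and closedness from here. -/
theorem SubseqClosedOn.image₂ {E E₁ E₂ A₁ A₂ A : Type*} [TopologicalSpace E] [TopologicalSpace E₁]
    [TopologicalSpace E₂] [TopologicalSpace A₁] [TopologicalSpace A₂] [TopologicalSpace A]
    {U : Set E} {U₁ : Set E₁} {U₂ : Set E₂} {J₁ : E₁ → Set A₁} {J₂ : E₂ → Set A₂}
    (h₁ : SubseqClosedOn U₁ J₁) (h₂ : SubseqClosedOn U₂ J₂) {f₁ : E → E₁} {f₂ : E → E₂}
    (c₁ : ContinuousOn f₁ U) (c₂ : ContinuousOn f₂ U) (m₁ : Set.MapsTo f₁ U U₁)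
    (m₂ : Set.MapsTo f₂ U U₂) {Ψ : A₁ → A₂ → A} (hΨ : Continuous fun p : A₁ × A₂ => Ψ p.1 p.2) :
    SubseqClosedOn U fun x => {a | ∃ b ∈ J₁ (f₁ x), ∃ c ∈ J₂ (f₂ x), a = Ψ b c} := by
  intro u a hu ha x hx hux
  choose b hb c hc habc using ha
  have hux' : Filter.Tendsto u Filter.atTop (𝓝[U] x) :=
    tendsto_nhdsWithin_iff.2 ⟨hux, Filter.Eventually.of_forall hu⟩
  obtain ⟨b', hb', φ, hφ, hbφ⟩ := h₁ (fun k => f₁ (u k)) b (fun k => m₁ (hu k)) hb (f₁ x) (m₁ hx)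
    ((c₁ x hx).tendsto.comp hux')
  obtain ⟨c', hc', ψ, hψ, hcψ⟩ := h₂ (fun k => f₂ (u (φ k))) (c ∘ φ) (fun k => m₂ (hu _))
    (fun k => hc _) (f₂ x) (m₂ hx) ((c₂ x hx).tendsto.comp (hux'.comp hφ.tendsto_atTop))
  refine ⟨Ψ b' c', ⟨b', hb', c', hc', rfl⟩, φ ∘ ψ, hφ.comp hψ, ?_⟩
  have := (hΨ.tendsto (b', c')).comp ((hbφ.comp hψ.tendsto_atTop).prodMk_nhds hcψ)
  refine this.congr fun k => ?_
  simp [habc]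

theorem SubseqClosedOn.comp {E E₁ A : Type*} [TopologicalSpace E] [TopologicalSpace E₁]
    [TopologicalSpace A] {U : Set E} {U₁ : Set E₁} {J : E₁ → Set A}
    (h : SubseqClosedOn U₁ J) {f : E → E₁} (c : ContinuousOn f U) (m : Set.MapsTo f U U₁) :
    SubseqClosedOn U fun x => J (f x) := by
  intro u a hu ha x hx hux
  exact h (fun k => f (u k)) a (fun k => m (hu k)) ha (f x) (m hx)
    ((c x hx).tendsto.comp (tendsto_nhdsWithin_iff.2 ⟨hux, Filter.Eventually.of_forall hu⟩))

theorem SubseqClosedOn.isCompact {E F : Type*} [TopologicalSpace E] [PseudoMetricSpace F]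
    {U : Set E} {J : E → Set F} (h : SubseqClosedOn U J) {x : E}
    (hx : x ∈ U) : IsCompact (J x) := by
  refine IsSeqCompact.isCompact fun a ha => ?_
  obtain ⟨b, hb, φ, hφ, h⟩ := h (fun _ => x) a (fun _ => hx) ha x hx tendsto_const_nhds
  exact ⟨b, hb, φ, hφ, h⟩

variable {E F : Type*} [NormedAddCommGroup E] [NormedSpace ℝ E]
  [NormedAddCommGroup F] [NormedSpace ℝ F]

theorem IsConservativeJacobianOn.subseqClosedOn [FiniteDimensional ℝ E] [FiniteDimensional ℝ F]
    {U : Set E} {f : E → F} {J : E → Set (E →L[ℝ] F)} (h : IsConservativeJacobianOn U f J) :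
    SubseqClosedOn U J := by
  intro u a hu ha x hx hux
  obtain ⟨C, N, hN, hC⟩ := h.locallyBounded x hx
  obtain ⟨k₀, hk₀⟩ := Filter.eventually_atTop.1 (hux.eventually_mem hN)
  have : ProperSpace (E →L[ℝ] F) := FiniteDimensional.proper ℝ _
  obtain ⟨b, -, φ, hφ, hb⟩ := (isCompact_closedBall (0 : E →L[ℝ] F) C).tendsto_subseq
    (x := fun k => a (k + k₀)) fun k => by
      simpa using hC _ ⟨hk₀ (k + k₀) (by lia), hu _⟩ _ (ha _)
  refine ⟨b, h.closedGraph x hx b ?_, fun k => φ k + k₀, fun i j hij => by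
    have := hφ hij; lia, hb⟩
  have hφ' : Filter.Tendsto (fun k => φ k + k₀) Filter.atTop Filter.atTop :=
    (Filter.tendsto_add_atTop_nat k₀).comp hφ.tendsto_atTop
  exact mem_closure_of_tendsto ((hux.comp hφ').prodMk_nhds hb)
    (Filter.Eventually.of_forall fun k => ⟨hu _, ha _⟩)

/-- Constructor for conservative Jacobians in terms of `SubseqClosedOn`. -/
theorem IsConservativeJacobianOn.of_subseqClosedOn {U : Set E} {f : E → F}
    {J : E → Set (E →L[ℝ] F)} (hne : ∀ x ∈ U, (J x).Nonempty) (h : SubseqClosedOn U J)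
    (hc : ∀ c : ℝ → E, AbsolutelyContinuousOnInterval c 0 1 →
      (∀ t ∈ Set.Icc (0 : ℝ) 1, c t ∈ U) →
      ∀ᵐ t ∂(MeasureTheory.volume.restrict (Set.Icc (0 : ℝ) 1)),
        ∀ A ∈ J (c t), HasDerivAt (fun s => f (c s)) (A (deriv c t)) t) :
    IsConservativeJacobianOn U f J where
  nonempty := hne
  locallyBounded x hx := by
    -- Unboundedness near `x` would give elements of norm `> k` over points converging to `x`, with
    -- no convergent subsequence.
    by_contra! hcon
    have : ∀ k : ℕ, ∃ y, (dist y x < 1 / ((k : ℝ) + 1) ∧ y ∈ U) ∧ ∃ A ∈ J y, (k : ℝ) < ‖A‖ := by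
      intro k
      obtain ⟨y, hy, A, hA, hk⟩ :=
        hcon k (Metric.ball x (1 / ((k : ℝ) + 1))) (Metric.ball_mem_nhds x (by positivity))
      exact ⟨y, ⟨hy.1, hy.2⟩, A, hA, hk⟩
    choose u hu A hA hk using this
    have hux : Filter.Tendsto u Filter.atTop (𝓝 x) := by
      rw [tendsto_iff_dist_tendsto_zero]
      exact squeeze_zero (fun _ => dist_nonneg) (fun k => (hu k).1.le)
        tendsto_one_div_add_atTop_nhds_zero_nat
    obtain ⟨B, -, φ, hφ, hB⟩ := h u A (fun k => (hu k).2) hA x hx hux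
    refine not_tendsto_nhds_of_tendsto_atTop ?_ _ hB.norm
    refine Filter.tendsto_atTop_mono (fun k => ?_) tendsto_natCast_atTop_atTop
    have : (k : ℝ) ≤ (φ k : ℝ) := by exact_mod_cast hφ.id_le k
    exact this.trans (hk (φ k)).le
  closedGraph x hx A hA := by
    obtain ⟨q, hq, hlim⟩ := mem_closure_iff_seq_limit.1 hA
    obtain ⟨B, hB, φ, hφ, hφB⟩ := h (fun k => (q k).1) (fun k => (q k).2) (fun k => (hq k).1)
      (fun k => (hq k).2) x hx hlim.fst_nhds
    have : A = B := tendsto_nhds_unique (hlim.snd_nhds.comp hφ.tendsto_atTop) hφB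
    rwa [this]
  chainRule := hc

end

/-! ### Convex hulls of set-valued maps. -/

section ConvexHull

variable {E A : Type*} [NormedAddCommGroup A] [NormedSpace ℝ A] [FiniteDimensional ℝ A]

/-- In finite dimension, the convex hull of a compact set is compact. -/
theorem IsCompact.convexHull_of_finiteDimensional {s : Set A} (hs : IsCompact s) :
    IsCompact (convexHull ℝ s) := by
  -- Carathéodory: at most `dim + 1` points suffice, so the hull is a finite union of continuous
  -- images of compact sets.
  have key : convexHull ℝ s = ⋃ n ∈ Set.Iic (Module.finrank ℝ A + 1),
      (fun p : (Fin n → ℝ) × (Fin n → A) => ∑ i, p.1 i • p.2 i) ''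
        (stdSimplex ℝ (Fin n) ×ˢ Set.univ.pi fun _ => s) := by
    apply Set.Subset.antisymm
    · intro x hx
      obtain ⟨ι, _, z, w, hz, hind, hw, hw1, hx⟩ := eq_pos_convex_span_of_mem_convexHull hx
      have hcard : Fintype.card ι ≤ Module.finrank ℝ A + 1 :=
        hind.card_le_finrank_succ.trans (Nat.succ_le_succ (Submodule.finrank_le _))
      let e := Fintype.equivFin ι
      refine Set.mem_biUnion (x := Fintype.card ι) hcard ⟨(w ∘ e.symm, z ∘ e.symm),
        ⟨⟨fun i => (hw _).le, ?_⟩, fun i _ => hz (Set.mem_range_self _)⟩, ?_⟩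
      · rw [← hw1]; exact e.symm.sum_comp w
      · rw [← hx]; exact e.symm.sum_comp fun i => w i • z i
    · refine Set.iUnion₂_subset fun n _ => ?_
      rintro _ ⟨⟨w, z⟩, ⟨hw, hz⟩, rfl⟩
      exact (convex_convexHull ℝ s).sum_mem (fun i _ => hw.1 i) hw.2
        fun i _ => subset_convexHull ℝ s (hz i (Set.mem_univ _))
  rw [key]
  refine (Set.finite_Iic _).isCompact_biUnion fun n _ => ?_
  refine IsCompact.image ((isCompact_stdSimplex ℝ _).prod (isCompact_univ_pi fun _ => hs)) ?_
  fun_prop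

/-- Bounded sequences in the hulls have limit points; a limit point outside the compact hull at `x`
would be strictly separated from it by a functional, which is impossible since each `a k` is
dominated by some element of `J (u k)`. -/
theorem SubseqClosedOn.convexHull [NormedAddCommGroup E] {U : Set E} {J : E → Set A}
    (h : SubseqClosedOn U J) : SubseqClosedOn U fun x => convexHull ℝ (J x) := by
  intro u a hu ha x hx hux
  have hcomp : ∀ y ∈ U, IsCompact (J y) := fun y hy => h.isCompact hy
  obtain ⟨C, hC⟩ : ∃ C : ℝ, ∀ k, ∀ b ∈ J (u k), ‖b‖ ≤ C := by
    by_contra! hcon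
    have hk : ∀ C : ℝ, ∃ k b, b ∈ J (u k) ∧ C < ‖b‖ := fun C => by
      obtain ⟨k, b, hb, hk⟩ := hcon C
      exact ⟨k, b, hb, hk⟩
    have hbd : ∀ k, ∃ C, ∀ b ∈ J (u k), ‖b‖ ≤ C := fun k =>
      (hcomp _ (hu k)).isBounded.exists_norm_le
    choose D hD using hbd
    have hk' : ∀ n : ℕ, ∃ k b, b ∈ J (u k) ∧ (n : ℝ) < ‖b‖ ∧ n ≤ k := fun n => by
      -- Norms above the sum of the first `n` bounds `D i` can only occur at indices `k ≥ n`, so the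
      -- bad base points still converge to `x`.
      obtain ⟨k, b, hb, hk⟩ := hk (max n (∑ i ∈ Finset.range n, |D i|))
      refine ⟨k, b, hb, (le_max_left _ _).trans_lt hk, ?_⟩
      by_contra! hlt
      have h1 : |D k| ≤ ∑ i ∈ Finset.range n, |D i| :=
        Finset.single_le_sum (f := fun i => |D i|) (fun i _ => abs_nonneg _)
          (Finset.mem_range.2 hlt)
      have h2 := (le_max_right _ _).trans_lt hk
      linarith [hD k b hb, le_abs_self (D k)]
    choose κ b hb hnb hκ using hk'
    have hκ' : Filter.Tendsto κ Filter.atTop Filter.atTop :=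
      Filter.tendsto_atTop_mono hκ Filter.tendsto_id
    obtain ⟨B, -, φ, hφ, hB⟩ := h (u ∘ κ) b (fun n => hu _) hb x hx (hux.comp hκ')
    refine not_tendsto_nhds_of_tendsto_atTop ?_ _ hB.norm
    refine Filter.tendsto_atTop_mono (fun k => ?_) tendsto_natCast_atTop_atTop
    have : (k : ℝ) ≤ (φ k : ℝ) := by exact_mod_cast hφ.id_le k
    exact this.trans (hnb (φ k)).le
  have : ProperSpace A := FiniteDimensional.proper ℝ _
  obtain ⟨b, -, φ, hφ, hb⟩ := (isCompact_closedBall (0 : A) C).tendsto_subseq (x := a) fun k =>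
    convexHull_min (fun b hb => by simpa using hC k b hb) (convex_closedBall _ _) (ha k)
  refine ⟨b, ?_, φ, hφ, hb⟩
  by_contra hnot
  obtain ⟨ψ, s, hs, hsb⟩ := geometric_hahn_banach_closed_point (convex_convexHull ℝ (J x))
    (hcomp x hx).convexHull_of_finiteDimensional.isClosed hnot
  -- Otherwise `J (u k)`, and so its hull, lies in an open half-space that misses `a k`.
  have : ∀ k, ∃ d ∈ J (u k), ψ (a k) ≤ ψ d := by
    intro k
    by_contra! hlt
    have : a k ∈ {y | ψ y < ψ (a k)} :=
      convexHull_min (fun d hd => hlt d hd) (convex_halfSpace_lt ψ.isLinear _) (ha k)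
    simp at this
  choose d hd hψ using this
  obtain ⟨d', hd', χ, hχ, hdχ⟩ := h (u ∘ φ) (d ∘ φ) (fun k => hu _) (fun k => hd _) x hx
    (hux.comp hφ.tendsto_atTop)
  have h1 : ψ b ≤ ψ d' := le_of_tendsto_of_tendsto'
    ((ψ.continuous.tendsto b).comp (hb.comp hχ.tendsto_atTop))
    ((ψ.continuous.tendsto d').comp hdχ) fun k => hψ _
  linarith [hs d' (subset_convexHull ℝ _ hd')]

end ConvexHull

/-! ### Absolutely continuous curves -/

section AbsolutelyContinuous

variable {X Y Z : Type*} [PseudoMetricSpace X] [PseudoMetricSpace Y]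

theorem LipschitzOnWith.comp_absolutelyContinuousOnInterval {f : X → Y} {K : NNReal} {c : ℝ → X}
    {a b : ℝ} (hf : LipschitzOnWith K f (c '' Set.uIcc a b))
    (hc : AbsolutelyContinuousOnInterval c a b) :
    AbsolutelyContinuousOnInterval (fun t => f (c t)) a b := by
  rw [absolutelyContinuousOnInterval_iff] at hc ⊢
  intro ε hε
  -- `K + 1` instead of `K` avoids a division by zero.
  obtain ⟨δ, hδ, h⟩ := hc (ε / (K + 1)) (by positivity)
  refine ⟨δ, hδ, fun E hE hEδ => ?_⟩
  have h1 := h E hE hEδ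
  calc ∑ i ∈ Finset.range E.1, dist (f (c (E.2 i).1)) (f (c (E.2 i).2))
      ≤ ∑ i ∈ Finset.range E.1, (K : ℝ) * dist (c (E.2 i).1) (c (E.2 i).2) :=
        Finset.sum_le_sum fun i hi => hf.dist_le_mul _ (Set.mem_image_of_mem c (hE.1 i hi).1) _
          (Set.mem_image_of_mem c (hE.1 i hi).2)
    _ = K * ∑ i ∈ Finset.range E.1, dist (c (E.2 i).1) (c (E.2 i).2) := by rw [Finset.mul_sum]
    _ ≤ (K + 1) * ∑ i ∈ Finset.range E.1, dist (c (E.2 i).1) (c (E.2 i).2) := by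
        refine mul_le_mul_of_nonneg_right (by linarith) (Finset.sum_nonneg fun i _ => ?_)
        exact dist_nonneg (x := c (E.2 i).1) (y := c (E.2 i).2)
    _ < (K + 1) * (ε / (K + 1)) := by gcongr
    _ = ε := by field_simp

theorem AbsolutelyContinuousOnInterval.prodMk {c : ℝ → X} {d : ℝ → Y} {a b : ℝ}
    (hc : AbsolutelyContinuousOnInterval c a b) (hd : AbsolutelyContinuousOnInterval d a b) :
    AbsolutelyContinuousOnInterval (fun t => (c t, d t)) a b := by
  refine squeeze_zero (fun E => Finset.sum_nonneg fun _ _ => dist_nonneg) (fun E => ?_)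
    (by simpa using Filter.Tendsto.add hc hd)
  rw [← Finset.sum_add_distrib]
  refine Finset.sum_le_sum fun i _ => ?_
  rw [Prod.dist_eq]
  exact max_le_add_of_nonneg dist_nonneg dist_nonneg

/-- The trace of the curve is compact, so `f` is Lipschitz on it. -/
theorem LocallyLipschitzOn.comp_absolutelyContinuousOnInterval {E F : Type*}
    [NormedAddCommGroup E] [NormedAddCommGroup F] {U : Set E} {f : E → F}
    (hf : LocallyLipschitzOn U f) {c : ℝ → E} (hc : AbsolutelyContinuousOnInterval c 0 1)
    (hU : ∀ t ∈ Set.Icc (0 : ℝ) 1, c t ∈ U) :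
    AbsolutelyContinuousOnInterval (fun t => f (c t)) 0 1 := by
  have hcpt : IsCompact (c '' Set.uIcc 0 1) := isCompact_uIcc.image_of_continuousOn hc.continuousOn
  have hsub : c '' Set.uIcc 0 1 ⊆ U := by
    rintro _ ⟨t, ht, rfl⟩
    exact hU t (by rwa [Set.uIcc_of_le zero_le_one] at ht)
  obtain ⟨K, hK⟩ := (hf.mono hsub).exists_lipschitzOnWith_of_compact hcpt
  exact hK.comp_absolutelyContinuousOnInterval hc

end AbsolutelyContinuous

section

variable {E F G : Type*} [NormedAddCommGroup E] [NormedSpace ℝ E]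
  [NormedAddCommGroup F] [NormedSpace ℝ F] [NormedAddCommGroup G] [NormedSpace ℝ G]

theorem AbsolutelyContinuousOnInterval.ae_hasDerivAt [FiniteDimensional ℝ E] {c : ℝ → E}
    (hc : AbsolutelyContinuousOnInterval c 0 1) :
    ∀ᵐ t ∂(MeasureTheory.volume.restrict (Set.Icc (0 : ℝ) 1)), HasDerivAt c (deriv c t) t := by
  rw [MeasureTheory.ae_restrict_iff' measurableSet_Icc]
  filter_upwards [hc.boundedVariationOn.ae_differentiableAt_of_mem_uIcc] with t ht hmem
  exact (ht (by rwa [Set.uIcc_of_le zero_le_one])).hasDerivAt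

/-- Discards the endpoints, so that identities known only for parameters in `[0, 1]` hold near the
parameter and can be differentiated. -/
theorem ae_restrict_Icc_mem_Ioo :
    ∀ᵐ t ∂(MeasureTheory.volume.restrict (Set.Icc (0 : ℝ) 1)), t ∈ Set.Ioo (0 : ℝ) 1 := by
  rw [← MeasureTheory.restrict_Ioo_eq_restrict_Icc]
  exact MeasureTheory.ae_restrict_mem measurableSet_Ioo

/-! ### Clarke Jacobians of path differentiable maps -/

/-- The limits of Jacobians of `f` along sequences of differentiability points converging
to `x`. -/
def limitingJacobian (f : E → F) (x : E) : Set (E →L[ℝ] F) :=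
  {A | ∃ u : ℕ → E, (∀ k, DifferentiableAt ℝ f (u k)) ∧
    Filter.Tendsto u Filter.atTop (𝓝 x) ∧
    Filter.Tendsto (fun k => fderiv ℝ f (u k)) Filter.atTop (𝓝 A)}

/-- Reduces estimates on Clarke Jacobians to differentiability points, provided the estimate defines
a closed convex set. -/
theorem clarkeJacobian_subset {f : E → F} {x : E} {C : Set (E →L[ℝ] F)} (hconv : Convex ℝ C)
    (hclosed : IsClosed C) (h : ∀ᶠ y in 𝓝 x, DifferentiableAt ℝ f y → fderiv ℝ f y ∈ C) :
    clarkeJacobian f x ⊆ C := by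
  refine convexHull_min ?_ hconv
  rintro A ⟨u, hu, hux, hA⟩
  refine hclosed.mem_of_tendsto hA ?_
  filter_upwards [hux.eventually h] with k hk using hk (hu k)

theorem LocallyLipschitzOn.exists_norm_fderiv_le {U : Set E} (hU : IsOpen U) {f : E → F}
    (hf : LocallyLipschitzOn U f) {x : E} (hx : x ∈ U) :
    ∃ C : ℝ, ∀ᶠ y in 𝓝 x, ‖fderiv ℝ f y‖ ≤ C := by
  obtain ⟨K, t, ht, hK⟩ := hf hx
  rw [hU.nhdsWithin_eq hx] at ht
  refine ⟨K, ?_⟩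
  filter_upwards [eventually_mem_nhds_iff.2 ht] with y hy
  exact norm_fderiv_le_of_lipschitzOn ℝ hy hK

/-- Rademacher: the non-differentiability set is null, while nonempty open sets have positive Haar
measure. -/
theorem LocallyLipschitzOn.frequently_differentiableAt [FiniteDimensional ℝ E]
    [FiniteDimensional ℝ F] {U : Set E} (hU : IsOpen U) {f : E → F}
    (hf : LocallyLipschitzOn U f) {x : E} (hx : x ∈ U) :
    ∃ᶠ y in 𝓝 x, DifferentiableAt ℝ f y := by
  let _ : MeasurableSpace E := borel E
  have : BorelSpace E := ⟨rfl⟩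
  obtain ⟨K, t, ht, hK⟩ := hf hx
  rw [hU.nhdsWithin_eq hx] at ht
  intro hcon
  obtain ⟨V, hV, hVo, hxV⟩ := mem_nhds_iff.1 (Filter.inter_mem ht hcon)
  have hae := hK.ae_differentiableWithinAt_of_mem (μ := MeasureTheory.Measure.addHaar)
  have hpos := hVo.measure_pos (MeasureTheory.Measure.addHaar) ⟨x, hxV⟩
  have hnull : MeasureTheory.Measure.addHaar V = 0 := by
    refine MeasureTheory.measure_mono_null (fun y hy => ?_) hae
    intro h
    refine (hV hy).2 ((h (hV hy).1).differentiableAt ?_)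
    exact Filter.mem_of_superset (hVo.mem_nhds hy) fun z hz => (hV hz).1
  exact hpos.ne' hnull

theorem limitingJacobian_nonempty [FiniteDimensional ℝ E]
    [FiniteDimensional ℝ F] {U : Set E} (hU : IsOpen U) {f : E → F}
    (hf : LocallyLipschitzOn U f) {x : E} (hx : x ∈ U) : (limitingJacobian f x).Nonempty := by
  obtain ⟨C, hC⟩ := hf.exists_norm_fderiv_le hU hx
  obtain ⟨u, hux, hu⟩ := Filter.exists_seq_forall_of_frequently
    ((hf.frequently_differentiableAt hU hx).and_eventually hC)
  have : ProperSpace (E →L[ℝ] F) := FiniteDimensional.proper ℝ _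
  obtain ⟨A, -, φ, hφ, hA⟩ := (isCompact_closedBall (0 : E →L[ℝ] F) C).tendsto_subseq
    (x := fun k => fderiv ℝ f (u k)) fun k => by simpa using (hu k).2
  exact ⟨A, u ∘ φ, fun k => (hu _).1, hux.comp hφ.tendsto_atTop, hA⟩

/-- A diagonal argument: each `a k` is replaced by an actual derivative within `1 / (k + 1)` of it,
taken within `1 / (k + 1)` of `u k`; these derivatives are eventually bounded. -/
theorem limitingJacobian_subseqClosedOn [FiniteDimensional ℝ E]
    [FiniteDimensional ℝ F] {U : Set E} (hU : IsOpen U) {f : E → F}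
    (hf : LocallyLipschitzOn U f) : SubseqClosedOn U (limitingJacobian f) := by
  intro u a hu ha x hx hux
  obtain ⟨C, hC⟩ := hf.exists_norm_fderiv_le hU hx
  choose v hvd hvu hva using ha
  have hex : ∀ k : ℕ, ∃ j, dist (v k j) (u k) < 1 / ((k : ℝ) + 1) ∧
      dist (fderiv ℝ f (v k j)) (a k) < 1 / ((k : ℝ) + 1) := fun k =>
    (((Metric.tendsto_nhds.1 (hvu k)) _ (by positivity)).and
      ((Metric.tendsto_nhds.1 (hva k)) _ (by positivity))).exists
  choose j hj hj' using hex
  have hw : Filter.Tendsto (fun k => v k (j k)) Filter.atTop (𝓝 x) := by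
    have : Filter.Tendsto (fun k => dist (u k) (v k (j k))) Filter.atTop (𝓝 0) :=
      squeeze_zero (fun _ => dist_nonneg) (fun k => by rw [dist_comm]; exact (hj k).le)
        tendsto_one_div_add_atTop_nhds_zero_nat
    exact (tendsto_iff_of_dist this).1 hux
  obtain ⟨k₀, hk₀⟩ := Filter.eventually_atTop.1 (hw.eventually hC)
  have : ProperSpace (E →L[ℝ] F) := FiniteDimensional.proper ℝ _
  obtain ⟨A, -, φ, hφ, hA⟩ := (isCompact_closedBall (0 : E →L[ℝ] F) C).tendsto_subseq
    (x := fun k => fderiv ℝ f (v (k + k₀) (j (k + k₀)))) fun k => by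
      simpa using hk₀ (k + k₀) (by lia)
  have hφ' : Filter.Tendsto (fun k => φ k + k₀) Filter.atTop Filter.atTop :=
    (Filter.tendsto_add_atTop_nat k₀).comp hφ.tendsto_atTop
  refine ⟨A, ⟨fun k => v (φ k + k₀) (j (φ k + k₀)), fun k => hvd _ _, hw.comp hφ', hA⟩,
    fun k => φ k + k₀, fun i j hij => by have := hφ hij; lia, ?_⟩
  have : Filter.Tendsto (fun k => dist (fderiv ℝ f (v k (j k))) (a k)) Filter.atTop (𝓝 0) :=
    squeeze_zero (fun _ => dist_nonneg) (fun k => (hj' k).le)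
      tendsto_one_div_add_atTop_nhds_zero_nat
  exact (tendsto_iff_of_dist (this.comp hφ')).1 hA

theorem clarkeJacobian_nonempty [FiniteDimensional ℝ E]
    [FiniteDimensional ℝ F] {U : Set E} (hU : IsOpen U) {f : E → F}
    (hf : LocallyLipschitzOn U f) {x : E} (hx : x ∈ U) : (clarkeJacobian f x).Nonempty :=
  (limitingJacobian_nonempty hU hf hx).mono (subset_convexHull ℝ _)

theorem clarkeJacobian_subseqClosedOn [FiniteDimensional ℝ E]
    [FiniteDimensional ℝ F] {U : Set E} (hU : IsOpen U) {f : E → F}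
    (hf : LocallyLipschitzOn U f) : SubseqClosedOn U (clarkeJacobian f) :=
  (limitingJacobian_subseqClosedOn hU hf).convexHull

/-- A directional mean value estimate: if all elements of a conservative Jacobian near `x` satisfy
`ψ (A v) ≤ s`, so does the derivative at `x`. -/
theorem IsConservativeJacobianOn.fderiv_apply_le {U : Set E} {f : E → F}
    {J : E → Set (E →L[ℝ] F)} (h : IsConservativeJacobianOn U f J) (hf : LocallyLipschitzOn U f)
    {W : Set E} (hWU : W ⊆ U) {x : E} (hxW : W ∈ 𝓝 x) (hd : DifferentiableAt ℝ f x)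
    (ψ : F →L[ℝ] ℝ) (v : E) {s : ℝ} (hs : ∀ y ∈ W, ∀ A ∈ J y, ψ (A v) ≤ s) :
    ψ (fderiv ℝ f x v) ≤ s := by
  -- Along the segment from `x` to `x + r v`, the chain rule bounds the derivative of `ψ ∘ f` by `s
  -- r` almost everywhere; absolute continuity allows integrating this.
  have hline : ∀ᶠ r : ℝ in 𝓝[>] 0, ψ (f (x + r • v)) - ψ (f x) ≤ s * r := by
    obtain ⟨ε, hε, hball⟩ := Metric.mem_nhds_iff.1 hxW
    have hδ : ∀ᶠ r : ℝ in 𝓝[>] 0, r * ‖v‖ < ε := by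
      have : Filter.Tendsto (fun r : ℝ => r * ‖v‖) (𝓝[>] 0) (𝓝 (0 * ‖v‖)) :=
        (Filter.tendsto_id.mono_left nhdsWithin_le_nhds).mul_const _
      rw [zero_mul] at this
      exact this.eventually_lt_const hε
    filter_upwards [hδ, self_mem_nhdsWithin] with r hr hr0
    have hr0 : 0 < r := hr0
    set c : ℝ → E := fun t => x + t • (r • v) with hc
    have hderiv : ∀ t, HasDerivAt c (r • v) t := fun t => by
      simpa [hc] using ((hasDerivAt_id t).smul_const (r • v)).const_add x
    have hcW : ∀ t ∈ Set.Icc (0 : ℝ) 1, c t ∈ W := fun t ht => by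
      refine hball ?_
      rw [Metric.mem_ball, dist_eq_norm, hc]
      simp only [add_sub_cancel_left]
      rw [norm_smul, norm_smul, Real.norm_of_nonneg ht.1, Real.norm_of_nonneg hr0.le]
      have h0 : 0 ≤ r * ‖v‖ := by positivity
      nlinarith [ht.2]
    have hcAC : AbsolutelyContinuousOnInterval c 0 1 := by
      have hcd : ContDiff ℝ 1 c := by rw [hc]; fun_prop
      exact hcd.contDiffOn.absolutelyContinuousOnInterval
    have hfc := hf.comp_absolutelyContinuousOnInterval hcAC fun t ht => hWU (hcW t ht)
    have hψ : AbsolutelyContinuousOnInterval (fun t => ψ (f (c t))) 0 1 :=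
      (ψ.lipschitz.lipschitzOnWith (s := _)).comp_absolutelyContinuousOnInterval hfc
    have hint := hψ.integral_deriv_eq_sub
    have hle : ∫ t in (0 : ℝ)..1, deriv (fun t => ψ (f (c t))) t ≤ ∫ _ in (0 : ℝ)..1, s * r := by
      refine intervalIntegral.integral_mono_ae_restrict zero_le_one hψ.intervalIntegrable_deriv
        intervalIntegrable_const ?_
      have hmem : ∀ᵐ t ∂(MeasureTheory.volume.restrict (Set.Icc (0 : ℝ) 1)),
          t ∈ Set.Icc (0 : ℝ) 1 := MeasureTheory.ae_restrict_mem measurableSet_Icc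
      filter_upwards [h.chainRule c hcAC fun t ht => hWU (hcW t ht), hmem] with t ht htm
      obtain ⟨A, hA⟩ := h.nonempty (c t) (hWU (hcW t htm))
      have hd' := ψ.hasFDerivAt.comp_hasDerivAt t (ht A hA)
      have : deriv (fun t => ψ (f (c t))) t = ψ (A (deriv c t)) := hd'.deriv
      rw [this, (hderiv t).deriv, map_smul, map_smul, smul_eq_mul, mul_comm s r]
      exact mul_le_mul_of_nonneg_left (hs _ (hcW t htm) A hA) hr0.le
    rw [hint] at hle
    simpa [hc] using hle
  have hdir : HasDerivAt (fun r : ℝ => ψ (f (x + r • v))) (ψ (fderiv ℝ f x v)) 0 := by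
    have h1 : HasDerivAt (fun r : ℝ => x + r • v) v 0 := by
      simpa using ((hasDerivAt_id (0 : ℝ)).smul_const v).const_add x
    have h2 : HasFDerivAt f (fderiv ℝ f x) (x + (0 : ℝ) • v) := by
      simpa using hd.hasFDerivAt
    exact ψ.hasFDerivAt.comp_hasDerivAt 0 (h2.comp_hasDerivAt 0 h1)
  have hslope := hdir.tendsto_slope_zero_right
  refine le_of_tendsto hslope ?_
  filter_upwards [hline, self_mem_nhdsWithin] with r hr hr0
  have hr0 : 0 < r := hr0
  simp only [zero_add, zero_smul, add_zero, smul_eq_mul]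
  rw [inv_mul_le_iff₀ hr0]
  linarith

/-- The Clarke Jacobian of a path differentiable map is a conservative Jacobian. -/
theorem PathDifferentiableOn.isConservativeJacobianOn_clarkeJacobian [FiniteDimensional ℝ E]
    [FiniteDimensional ℝ F] {U : Set E} (hU : IsOpen U) {f : E → F}
    (hf : PathDifferentiableOn U f) : IsConservativeJacobianOn U f (clarkeJacobian f) := by
  obtain ⟨hlip, J, hJ⟩ := hf
  have hJs := hJ.subseqClosedOn
  -- The support function of the Clarke Jacobian, tested on `ψ` and `v`, is at most that of `J x`:
  -- closedness of `J` spreads the bound to nearby points, where the mean value estimate applies.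
  have key : ∀ x ∈ U, ∀ (ψ : F →L[ℝ] ℝ) (v : E) (s : ℝ), (∀ B ∈ J x, ψ (B v) < s) →
      ∀ A ∈ clarkeJacobian f x, ψ (A v) ≤ s := by
    intro x hx ψ v s hB
    have hev : ∀ᶠ y in 𝓝 x, y ∈ U ∧ ∀ B ∈ J y, ψ (B v) ≤ s := by
      by_contra hcon
      have hfr : ∃ᶠ y in 𝓝 x, y ∈ U ∧ ∃ B ∈ J y, s < ψ (B v) := by
        have h1 := (Filter.not_eventually.1 hcon).and_eventually (hU.mem_nhds hx)
        refine h1.mono fun y hy => ⟨hy.2, ?_⟩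
        by_contra! h2
        exact hy.1 ⟨hy.2, h2⟩
      obtain ⟨u, hux, hu⟩ := Filter.exists_seq_forall_of_frequently hfr
      choose hu' a ha has using hu
      obtain ⟨B, hBx, φ, hφ, hlim⟩ := hJs u a hu' ha x hx hux
      have hcont : Continuous fun B : E →L[ℝ] F => ψ (B v) := by fun_prop
      have : s ≤ ψ (B v) := ge_of_tendsto' ((hcont.tendsto B).comp hlim) fun k => (has _).le
      exact absurd (hB B hBx) (not_lt.2 this)
    have hsub : clarkeJacobian f x ⊆ {A | ψ (A v) ≤ s} := by
      refine clarkeJacobian_subset ?_ ?_ ?_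
      · intro A hA B hB a b ha hb hab
        simp only [Set.mem_ofPred_eq] at hA hB ⊢
        simp only [add_apply, smul_apply, map_add,
          map_smul, smul_eq_mul]
        calc a * ψ (A v) + b * ψ (B v) ≤ a * s + b * s := by gcongr
          _ = s := by rw [← add_mul, hab, one_mul]
      · exact isClosed_le (by fun_prop) continuous_const
      · filter_upwards [eventually_mem_nhds_iff.2 hev] with y hy hd
        exact hJ.fderiv_apply_le hlip (fun z hz => hz.1) hy hd ψ v fun z hz => hz.2
    exact fun A hA => hsub hA
  refine .of_subseqClosedOn (fun x hx => clarkeJacobian_nonempty hU hlip hx)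
    (clarkeJacobian_subseqClosedOn hU hlip) fun c hc hcU => ?_
  have hmem : ∀ᵐ t ∂(MeasureTheory.volume.restrict (Set.Icc (0 : ℝ) 1)),
      t ∈ Set.Icc (0 : ℝ) 1 := MeasureTheory.ae_restrict_mem measurableSet_Icc
  filter_upwards [hJ.chainRule c hc hcU, hmem] with t ht htm A hA
  obtain ⟨B₀, hB₀⟩ := hJ.nonempty _ (hcU t htm)
  -- All elements of `J` agree on the velocity, so the support function bounds for `ψ` and `-ψ` pin
  -- down `A (deriv c t)`.
  have heq : ∀ B ∈ J (c t), B (deriv c t) = B₀ (deriv c t) := fun B hB =>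
    (ht B hB).unique (ht B₀ hB₀)
  have hle : ∀ ψ : F →L[ℝ] ℝ, ψ (A (deriv c t)) ≤ ψ (B₀ (deriv c t)) := fun ψ =>
    le_of_forall_gt_imp_ge_of_dense fun s hs =>
      key _ (hcU t htm) ψ _ s (fun B hB => by rwa [heq B hB]) A hA
  have : A (deriv c t) = B₀ (deriv c t) := by
    refine (SeparatingDual.eq_iff_forall_dual_eq (R := ℝ)).2 fun ψ =>
      le_antisymm (hle ψ) ?_
    have := hle (-ψ)
    simpa using this
  rw [this]
  exact ht B₀ hB₀

end

/-! ### Calculus of conservative Jacobians -/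

section

theorem LocallyLipschitzOn.comp_of_mapsTo {α β γ : Type*} [PseudoEMetricSpace α]
    [PseudoEMetricSpace β] [PseudoEMetricSpace γ] {U : Set α} {V : Set β} {g : β → γ} {f : α → β}
    (hg : LocallyLipschitzOn V g) (hf : LocallyLipschitzOn U f) (h : Set.MapsTo f U V) :
    LocallyLipschitzOn U fun x => g (f x) := by
  intro x hx
  obtain ⟨K, t, ht, hK⟩ := hg (h hx)
  obtain ⟨L, s, hs, hL⟩ := hf hx
  have hfc : Filter.Tendsto f (𝓝[U] x) (𝓝[V] f x) :=
    tendsto_nhdsWithin_iff.2 ⟨hf.continuousOn x hx, by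
      filter_upwards [self_mem_nhdsWithin] with y hy using h hy⟩
  exact ⟨K * L, s ∩ f ⁻¹' t, Filter.inter_mem hs (hfc ht),
    hK.comp (hL.mono Set.inter_subset_left) fun y hy => hy.2⟩

theorem LocallyLipschitzOn.prodMk {α β γ : Type*} [PseudoEMetricSpace α]
    [PseudoEMetricSpace β] [PseudoEMetricSpace γ] {U : Set α} {f : α → β} {g : α → γ}
    (hf : LocallyLipschitzOn U f) (hg : LocallyLipschitzOn U g) :
    LocallyLipschitzOn U fun x => (f x, g x) := by
  intro x hx
  obtain ⟨K, t, ht, hK⟩ := hf hx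
  obtain ⟨L, s, hs, hL⟩ := hg hx
  refine ⟨max K L, t ∩ s, Filter.inter_mem ht hs, ?_⟩
  exact LipschitzOnWith.prodMk (hK.mono Set.inter_subset_left) (hL.mono Set.inter_subset_right)

theorem SubseqClosedOn.singleton {E A : Type*} [TopologicalSpace E] [TopologicalSpace A]
    {U : Set E} {f : E → A} (hf : ContinuousOn f U) : SubseqClosedOn U fun x => {f x} := by
  intro u a hu ha x hx hux
  refine ⟨f x, rfl, id, strictMono_id, ?_⟩
  refine ((hf x hx).tendsto.comp (tendsto_nhdsWithin_iff.2
    ⟨hux, Filter.Eventually.of_forall hu⟩)).congr fun k => ?_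
  exact (ha k).symm

variable {E F G H : Type*} [NormedAddCommGroup E] [NormedSpace ℝ E] [FiniteDimensional ℝ E]
  [NormedAddCommGroup F] [NormedSpace ℝ F] [FiniteDimensional ℝ F]
  [NormedAddCommGroup G] [NormedSpace ℝ G] [FiniteDimensional ℝ G]
  [NormedAddCommGroup H] [NormedSpace ℝ H]

omit [FiniteDimensional ℝ F] in
theorem ContinuousLinearMap.isConservativeJacobianOn (L : E →L[ℝ] F) (U : Set E) :
    IsConservativeJacobianOn U L fun _ => {L} := by
  refine .of_subseqClosedOn (fun x _ => Set.singleton_nonempty _)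
    (SubseqClosedOn.singleton continuousOn_const) fun c hc _ => ?_
  filter_upwards [hc.ae_hasDerivAt] with t ht A hA
  obtain rfl : A = L := hA
  exact A.hasFDerivAt.comp_hasDerivAt t ht

/-- The single form `ℓ - T ∘ φ` covers the forward step, the residual, Moreau's identity and the
rescaling equation for proximal maps. -/
theorem IsConservativeJacobianOn.sub_comp {U : Set E} {V : Set F} {φ : E → F} {T : F → G}
    {Jφ : E → Set (E →L[ℝ] F)} {JT : F → Set (F →L[ℝ] G)} (hT : IsConservativeJacobianOn V T JT)
    (hφ : IsConservativeJacobianOn U φ Jφ) (hlip : LocallyLipschitzOn U φ)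
    (hm : Set.MapsTo φ U V) (ℓ : E →L[ℝ] G) :
    IsConservativeJacobianOn U (fun x => ℓ x - T (φ x))
      fun x => {D | ∃ M ∈ JT (φ x), ∃ N ∈ Jφ x, D = ℓ - M ∘L N} := by
  refine .of_subseqClosedOn (fun x hx => ?_)
    (hT.subseqClosedOn.image₂ hφ.subseqClosedOn hlip.continuousOn continuousOn_id hm
      (Set.mapsTo_id U) (Ψ := fun M N => ℓ - M ∘L N) (by fun_prop)) fun c hc hcU => ?_
  · obtain ⟨M, hM⟩ := hT.nonempty _ (hm hx)
    obtain ⟨N, hN⟩ := hφ.nonempty _ hx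
    exact ⟨_, M, hM, N, hN, rfl⟩
  · filter_upwards [hc.ae_hasDerivAt, hφ.chainRule c hc hcU,
      hT.chainRule (fun t => φ (c t)) (hlip.comp_absolutelyContinuousOnInterval hc hcU)
        fun t ht => hm (hcU t ht)] with t h1 h2 h3
    rintro _ ⟨M, hM, N, hN, rfl⟩
    have h4 := h3 M hM
    rw [(h2 N hN).deriv] at h4
    exact (ℓ.hasFDerivAt.comp_hasDerivAt t h1).sub h4

theorem IsConservativeJacobianOn.prodMap_clm [FiniteDimensional ℝ H] {U : Set E} {V : Set F} {W : Set G} {H' : Type*}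
    [NormedAddCommGroup H'] [NormedSpace ℝ H'] [FiniteDimensional ℝ H']
    {f₁ : F → H} {f₂ : G → H'} {J₁ : F → Set (F →L[ℝ] H)} {J₂ : G → Set (G →L[ℝ] H')}
    (h₁ : IsConservativeJacobianOn V f₁ J₁) (h₂ : IsConservativeJacobianOn W f₂ J₂)
    (L₁ : E →L[ℝ] F) (L₂ : E →L[ℝ] G) (m₁ : Set.MapsTo L₁ U V) (m₂ : Set.MapsTo L₂ U W) :
    IsConservativeJacobianOn U (fun x => (f₁ (L₁ x), f₂ (L₂ x)))
      fun x => {D | ∃ M ∈ J₁ (L₁ x), ∃ N ∈ J₂ (L₂ x), D = (M ∘L L₁).prod (N ∘L L₂)} := by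
  refine .of_subseqClosedOn (fun x hx => ?_)
    (h₁.subseqClosedOn.image₂ h₂.subseqClosedOn L₁.continuous.continuousOn
      L₂.continuous.continuousOn m₁ m₂ (Ψ := fun M N => (M ∘L L₁).prod (N ∘L L₂)) ?_)
      fun c hc hcU => ?_
  · obtain ⟨M, hM⟩ := h₁.nonempty _ (m₁ hx)
    obtain ⟨N, hN⟩ := h₂.nonempty _ (m₂ hx)
    exact ⟨_, M, hM, N, hN, rfl⟩
  · have h : (fun p : (F →L[ℝ] H) × (G →L[ℝ] H') => (p.1 ∘L L₁).prod (p.2 ∘L L₂)) =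
        fun p => ContinuousLinearMap.inl ℝ H H' ∘L (p.1 ∘L L₁) +
          ContinuousLinearMap.inr ℝ H H' ∘L (p.2 ∘L L₂) := by
      ext p x <;> simp
    rw [h]
    fun_prop
  · have hL₁ : LocallyLipschitzOn U L₁ := L₁.lipschitz.locallyLipschitz.locallyLipschitzOn
    have hL₂ : LocallyLipschitzOn U L₂ := L₂.lipschitz.locallyLipschitz.locallyLipschitzOn
    filter_upwards [hc.ae_hasDerivAt,
      h₁.chainRule (fun t => L₁ (c t)) (hL₁.comp_absolutelyContinuousOnInterval hc hcU)
        fun t ht => m₁ (hcU t ht),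
      h₂.chainRule (fun t => L₂ (c t)) (hL₂.comp_absolutelyContinuousOnInterval hc hcU)
        fun t ht => m₂ (hcU t ht)] with t h1 h2 h3
    rintro _ ⟨M, hM, N, hN, rfl⟩
    have h4 := h2 M hM
    have h5 := h3 N hN
    have h6 : HasDerivAt (fun t => L₁ (c t)) (L₁ (deriv c t)) t :=
      L₁.hasFDerivAt.comp_hasDerivAt t h1
    rw [h6.deriv] at h4
    have h7 : HasDerivAt (fun t => L₂ (c t)) (L₂ (deriv c t)) t :=
      L₂.hasFDerivAt.comp_hasDerivAt t h1
    rw [h7.deriv] at h5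
    exact h4.prodMk h5

/-- `(θ, z) ↦ b (K θ) z` is path differentiable for bilinear `b` and path differentiable `K`. -/
theorem PathDifferentiableOn.bilinear {Θ : Set E} {K : E → F} (hK : PathDifferentiableOn Θ K)
    (b : F →L[ℝ] G →L[ℝ] H) :
    PathDifferentiableOn (Θ ×ˢ (Set.univ : Set G)) fun q : E × G => b (K q.1) q.2 := by
  obtain ⟨hlip, J, hJ⟩ := hK
  have hfst : LocallyLipschitzOn (Θ ×ˢ (Set.univ : Set G)) (Prod.fst : E × G → E) :=
    LipschitzWith.prod_fst.locallyLipschitz.locallyLipschitzOn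
  have hsnd : LocallyLipschitzOn (Θ ×ˢ (Set.univ : Set G)) (Prod.snd : E × G → G) :=
    LipschitzWith.prod_snd.locallyLipschitz.locallyLipschitzOn
  have hm : Set.MapsTo (Prod.fst : E × G → E) (Θ ×ˢ (Set.univ : Set G)) Θ := fun q hq => hq.1
  have hK' := hlip.comp_of_mapsTo hfst hm
  have hpair := hK'.prodMk hsnd
  have hb : ContDiff ℝ 1 fun p : F × G => b p.1 p.2 := by fun_prop
  refine ⟨hb.locallyLipschitz.locallyLipschitzOn.comp_of_mapsTo hpair (Set.mapsTo_univ _ _),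
    -- The base point enters as a singleton-valued map, so that `SubseqClosedOn.image₂` applies.
    fun q => {N | ∃ A ∈ J q.1, ∃ p ∈ ({(K q.1, q.2)} : Set (F × G)),
      N = (b.flip p.2 ∘L A).coprod (b p.1)},
    .of_subseqClosedOn (fun q hq => ?_) ?_ fun c hc hcU => ?_⟩
  · obtain ⟨A, hA⟩ := hJ.nonempty _ hq.1
    exact ⟨_, A, hA, _, rfl, rfl⟩
  · refine SubseqClosedOn.image₂ (f₂ := id) hJ.subseqClosedOn
      (SubseqClosedOn.singleton hpair.continuousOn)
      continuous_fst.continuousOn continuousOn_id hm (Set.mapsTo_id _)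
      (Ψ := fun A p => (b.flip p.2 ∘L A).coprod (b p.1)) ?_
    have h : (fun p : (E →L[ℝ] F) × (F × G) => (b.flip p.2.2 ∘L p.1).coprod (b p.2.1)) =
        fun p => (b.flip p.2.2 ∘L p.1) ∘L ContinuousLinearMap.fst ℝ E G +
          (b p.2.1) ∘L ContinuousLinearMap.snd ℝ E G := by
      ext p x <;> simp
    rw [h]
    fun_prop
  · have hc1 : AbsolutelyContinuousOnInterval (fun t => (c t).1) 0 1 :=
      hfst.comp_absolutelyContinuousOnInterval hc hcU
    filter_upwards [hc.ae_hasDerivAt, hJ.chainRule _ hc1 fun t ht => (hcU t ht).1] with t h1 h2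
    rintro _ ⟨A, hA, p, rfl, rfl⟩
    have h3 := h2 A hA
    have h4 : HasDerivAt (fun t => (c t).1) (deriv c t).1 t :=
      (ContinuousLinearMap.fst ℝ E G).hasFDerivAt.comp_hasDerivAt t h1
    have h5 : HasDerivAt (fun t => (c t).2) (deriv c t).2 t :=
      (ContinuousLinearMap.snd ℝ E G).hasFDerivAt.comp_hasDerivAt t h1
    rw [h4.deriv] at h3
    have h6 := (b.hasFDerivAt.comp_hasDerivAt t h3).clm_apply h5
    simpa using h6

end

/-! ### Implicit functions -/

section

variable {P Z : Type*} [NormedAddCommGroup P] [NormedSpace ℝ P]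
  [NormedAddCommGroup Z] [NormedSpace ℝ Z]

/-- The expansion bound on `R (θ', ·)` turns the distance between zeros into the change of `R (·, z
θ)` between `θ` and `θ'`, which is Lipschitz in the parameter. -/
theorem locallyLipschitzOn_of_implicit {P Z : Type*} [PseudoMetricSpace P] [NormedAddCommGroup Z]
    {Θ : Set P} {R : P × Z → Z}
    (hR : LocallyLipschitzOn (Θ ×ˢ (Set.univ : Set Z)) R) {C : NNReal}
    (hC : ∀ θ ∈ Θ, ∀ z z', dist z z' ≤ C * dist (R (θ, z)) (R (θ, z'))) {z : P → Z}
    (hz : ∀ θ ∈ Θ, R (θ, z θ) = 0) : LocallyLipschitzOn Θ z := by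
  intro θ₀ hθ₀
  obtain ⟨K, t, ht, hK⟩ := hR (x := (θ₀, z θ₀)) ⟨hθ₀, Set.mem_univ _⟩
  obtain ⟨ε, hε, hball⟩ := Metric.mem_nhdsWithin_iff.1 ht
  have hmem : ∀ θ ∈ Θ, dist θ θ₀ < ε → ∀ w, dist w (z θ₀) < ε → (θ, w) ∈ t :=
    fun θ hθ hd w hw => hball ⟨by rw [Metric.mem_ball, Prod.dist_eq]; exact max_lt hd hw,
      hθ, Set.mem_univ _⟩
  have hstep : ∀ θ ∈ Θ, ∀ θ' ∈ Θ, (θ, z θ) ∈ t → (θ', z θ) ∈ t →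
      dist (z θ) (z θ') ≤ C * K * dist θ θ' := by
    intro θ hθ θ' hθ' h1 h2
    calc dist (z θ) (z θ') ≤ C * dist (R (θ', z θ)) (R (θ', z θ')) := hC θ' hθ' _ _
      _ = C * dist (R (θ', z θ)) (R (θ, z θ)) := by rw [hz θ hθ, hz θ' hθ']
      _ ≤ C * (K * dist (θ', z θ) (θ, z θ)) := by gcongr; exact hK.dist_le_mul _ h2 _ h1
      _ = C * K * dist θ θ' := by
        rw [Prod.dist_eq, dist_self, max_eq_left dist_nonneg, dist_comm θ' θ, mul_assoc]
  -- Continuity of `z` is not known in advance. Comparing from `θ₀` uses only the points `(θ₀, z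
  -- θ₀)` and `(θ, z θ₀)`, and the radius ensures both `dist θ θ₀ < ε` and `C K dist θ θ₀ < ε`.
  have hnear : ∀ θ ∈ Θ, dist θ θ₀ < ε / (C * K + 1) → dist θ θ₀ < ε ∧ dist (z θ) (z θ₀) < ε := by
    intro θ hθ hd
    have hpos : (0 : ℝ) < C * K + 1 := by positivity
    have hd' : (C * K + 1) * dist θ θ₀ < ε := by rwa [lt_div_iff₀' hpos] at hd
    have hlt : dist θ θ₀ < ε := by
      have : 0 ≤ (C : ℝ) * K * dist θ θ₀ := by positivity
      linarith
    refine ⟨hlt, ?_⟩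
    have := hstep θ₀ hθ₀ θ hθ (hmem _ hθ₀ (by simpa) _ (by simpa)) (hmem _ hθ hlt _ (by simpa))
    rw [dist_comm (z θ), dist_comm θ] at *
    have h0 : 0 ≤ dist θ₀ θ := dist_nonneg
    linarith
  refine ⟨C * K, Metric.ball θ₀ (ε / (C * K + 1)) ∩ Θ,
    Filter.inter_mem (mem_nhdsWithin_of_mem_nhds (Metric.ball_mem_nhds _ (by positivity)))
      self_mem_nhdsWithin, LipschitzOnWith.of_dist_le_mul fun θ hθ θ' hθ' => ?_⟩
  have h1 := hnear θ hθ.2 hθ.1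
  have h2 := hnear θ' hθ'.2 hθ'.1
  simpa using hstep θ hθ.2 θ' hθ'.2 (hmem _ hθ.2 h1.1 _ h1.2) (hmem _ hθ'.2 h2.1 _ h1.2)

/-- The implicit function theorem for conservative Jacobians. -/
theorem IsConservativeJacobianOn.implicit [FiniteDimensional ℝ P] [FiniteDimensional ℝ Z]
    {Θ : Set P} {R : P × Z → Z}
    {J : P × Z → Set (P × Z →L[ℝ] Z)}
    (hJ : IsConservativeJacobianOn (Θ ×ˢ (Set.univ : Set Z)) R J) {z : P → Z}
    (hlip : LocallyLipschitzOn Θ z) (hz : ∀ θ ∈ Θ, R (θ, z θ) = 0)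
    (hinv : ∀ θ ∈ Θ, ∀ D ∈ J (θ, z θ), (partialSnd D).IsInvertible) :
    IsConservativeJacobianOn Θ z fun θ => implicitJacobian (J (θ, z θ)) := by
  have hpair : LocallyLipschitzOn Θ fun θ => (θ, z θ) :=
    LocallyLipschitz.id.locallyLipschitzOn.prodMk hlip
  have hm : Set.MapsTo (fun θ => (θ, z θ)) Θ (Θ ×ˢ (Set.univ : Set Z)) :=
    fun θ hθ => ⟨hθ, Set.mem_univ _⟩
  refine .of_subseqClosedOn (fun θ hθ => ?_) ?_ fun c hc hcU => ?_
  · obtain ⟨D, hD⟩ := hJ.nonempty _ (hm hθ)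
    exact ⟨_, D, hD, rfl⟩
  · intro u a hu ha θ hθ huθ
    choose D hD ha using ha
    obtain ⟨D', hD', φ, hφ, hlim⟩ :=
      (hJ.subseqClosedOn.comp hpair.continuousOn hm) u D hu hD θ hθ huθ
    refine ⟨_, ⟨D', hD', rfl⟩, φ, hφ, ?_⟩
    obtain ⟨e, he⟩ := hinv θ hθ D' hD'
    have h1 : Filter.Tendsto (fun k => partialSnd (D (φ k))) Filter.atTop (𝓝 (partialSnd D')) :=
      ((by unfold partialSnd; fun_prop :
        Continuous fun D : P × Z →L[ℝ] Z => partialSnd D).tendsto D').comp hlim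
    have h2 : Filter.Tendsto (fun k => partialFst (D (φ k))) Filter.atTop (𝓝 (partialFst D')) :=
      ((by unfold partialFst; fun_prop :
        Continuous fun D : P × Z →L[ℝ] Z => partialFst D).tendsto D').comp hlim
    have : CompleteSpace Z := FiniteDimensional.complete ℝ Z
    -- Inversion is continuous at invertible operators, so the limit passes through `-V⁻¹ U`.
    have h3 : ContinuousAt ContinuousLinearMap.inverse (partialSnd D') := by
      rw [← he]
      exact (contDiffAt_map_inverse (n := 0) e).continuousAt
    have h4 := h3.tendsto.comp h1
    have h5 : Continuous fun p : (Z →L[ℝ] Z) × (P →L[ℝ] Z) => -(p.1 ∘L p.2) := by fun_prop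
    refine ((h5.tendsto (_, _)).comp (h4.prodMk_nhds h2)).congr fun k => ?_
    simp [ha]
  · have hzc := hlip.comp_absolutelyContinuousOnInterval hc hcU
    have hpc := hpair.comp_absolutelyContinuousOnInterval hc hcU
    filter_upwards [hc.ae_hasDerivAt, hzc.ae_hasDerivAt,
      hJ.chainRule _ hpc fun t ht => hm (hcU t ht), ae_restrict_Icc_mem_Ioo] with t h1 h2 h3 ht
    rintro _ ⟨D, hD, rfl⟩
    have h4 := h3 D hD
    rw [(h1.prodMk h2).deriv] at h4
    -- The residual vanishes identically along the curve near the interior parameter `t`.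
    have h5 : HasDerivAt (fun s => R (c s, z (c s))) 0 t := by
      refine (hasDerivAt_const t (0 : Z)).congr_of_eventuallyEq ?_
      filter_upwards [Ioo_mem_nhds ht.1 ht.2] with s hs
      exact hz _ (hcU s ⟨hs.1.le, hs.2.le⟩)
    have h6 := h4.unique h5
    have hI := hinv _ (hcU t ⟨ht.1.le, ht.2.le⟩) D hD
    have h7 : partialFst D (deriv c t) + partialSnd D (deriv (fun t => z (c t)) t) = 0 := by
      rw [← h6]
      simp only [partialFst, partialSnd, ContinuousLinearMap.comp_apply, ← map_add]
      simp
    have h8 : -((partialSnd D).inverse ∘L partialFst D) (deriv c t) =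
        deriv (fun t => z (c t)) t := by
      rw [ContinuousLinearMap.comp_apply, eq_neg_of_add_eq_zero_left h7, map_neg,
        hI.inverse_apply_self, neg_neg]
    rw [neg_apply, h8]
    exact h2

end

/-! ### Convex analysis -/

section

theorem EReal.coe_mul_le_coe_iff {γ : ℝ} (hγ : 0 < γ) (x : EReal) (s : ℝ) :
    (γ : EReal) * x ≤ s ↔ x ≤ ((s / γ : ℝ) : EReal) := by
  induction x with
  | bot => simp [EReal.coe_mul_bot_of_pos hγ]
  | top => simp [EReal.coe_mul_top_of_pos hγ]
  | coe x =>
    rw [← EReal.coe_mul, EReal.coe_le_coe_iff, EReal.coe_le_coe_iff, le_div_iff₀' hγ]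

theorem EReal.coe_mul_ne_bot {γ : ℝ} (hγ : 0 < γ) {x : EReal} (hx : x ≠ ⊥) :
    (γ : EReal) * x ≠ ⊥ := by
  induction x with
  | bot => exact absurd rfl hx
  | top => simp [EReal.coe_mul_top_of_pos hγ]
  | coe x => rw [← EReal.coe_mul]; exact EReal.coe_ne_bot _

theorem EReal.add_coe_le_coe_iff (x : EReal) (q s : ℝ) :
    x + (q : EReal) ≤ s ↔ x ≤ ((s - q : ℝ) : EReal) := by
  induction x with
  | bot => simp
  | top => simp only [EReal.top_add_coe, top_le_iff, EReal.coe_ne_top]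
  | coe x =>
    rw [← EReal.coe_add, EReal.coe_le_coe_iff, EReal.coe_le_coe_iff]
    constructor <;> intro h <;> linarith

theorem EReal.coe_sub_le_coe_iff {x : EReal} (hx : x ≠ ⊥) (q s : ℝ) :
    (q : EReal) - x ≤ s ↔ ((q - s : ℝ) : EReal) ≤ x := by
  induction x with
  | bot => exact absurd rfl hx
  | top => simp
  | coe x =>
    rw [← EReal.coe_sub, EReal.coe_le_coe_iff, EReal.coe_le_coe_iff]
    constructor <;> intro h <;> linarith

theorem EReal.coe_le_coe_sub_iff (x : EReal) (q s : ℝ) :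
    (s : EReal) ≤ (q : EReal) - x ↔ x ≤ ((q - s : ℝ) : EReal) := by
  induction x with
  | bot => simp
  | top => simp only [EReal.sub_top, le_bot_iff, EReal.coe_ne_bot, top_le_iff, EReal.coe_ne_top]
  | coe x =>
    rw [← EReal.coe_sub, EReal.coe_le_coe_iff, EReal.coe_le_coe_iff]
    constructor <;> intro h <;> linarith

/-- Lower bounds are tested on real upper bounds of `x`, that is, on the epigraph; this keeps
convexity arguments free of arithmetic with infinities. -/
theorem EReal.coe_le_of_forall_le_coe {x : EReal} {r : ℝ} (h : ∀ s : ℝ, x ≤ s → r ≤ s) :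
    (r : EReal) ≤ x := by
  induction x with
  | bot => exact absurd (h (r - 1) bot_le) (by linarith)
  | top => exact le_top
  | coe x => exact EReal.coe_le_coe_iff.2 (h x le_rfl)

theorem eq_of_mul_norm_sub_sq_nonpos {V : Type*} [NormedAddCommGroup V] {a b : V} {ρ : ℝ}
    (hρ : 0 < ρ) (h : ρ / 2 * ‖a - b‖ ^ 2 ≤ 0) : a = b := by
  have h0 : ‖a - b‖ ^ 2 ≤ 0 := by
    by_contra! hcon
    have : 0 < ρ / 2 * ‖a - b‖ ^ 2 := by positivity
    linarith
  exact sub_eq_zero.1 (norm_eq_zero.1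
    (pow_eq_zero_iff two_ne_zero |>.1 (le_antisymm h0 (sq_nonneg _))))

variable {E : Type*} [NormedAddCommGroup E] [InnerProductSpace ℝ E] {h : E → EReal}

/-- Strong convexity in terms of the epigraph. -/
theorem stronglyConvexFun_iff (hb : ∀ x, h x ≠ ⊥) (μ : ℝ) :
    StronglyConvexFun μ h ↔ ∀ x y : E, ∀ r s : ℝ, h x ≤ r → h y ≤ s → ∀ a b : ℝ, 0 < a → 0 < b →
      a + b = 1 → h (a • x + b • y) ≤ ((a * r + b * s - μ / 2 * (a * b) * ‖x - y‖ ^ 2 : ℝ) : EReal) := by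
  constructor
  · intro H x y r s hr hs a b ha hb' hab
    rw [← EReal.add_coe_le_coe_iff]
    refine (H x y a b ha hb' hab).trans ?_
    rw [EReal.coe_add, EReal.coe_mul, EReal.coe_mul]
    exact add_le_add (mul_le_mul_of_nonneg_left hr (by exact_mod_cast ha.le))
      (mul_le_mul_of_nonneg_left hs (by exact_mod_cast hb'.le))
  · intro H x y a b ha hb' hab
    have hbx := hb x
    have hby := hb y
    rcases eq_or_ne (h x) ⊤ with hx | hx
    · rw [hx, EReal.coe_mul_top_of_pos ha, EReal.top_add_of_ne_bot]
      · exact le_top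
      · exact EReal.coe_mul_ne_bot hb' hby
    rcases eq_or_ne (h y) ⊤ with hy | hy
    · rw [hy, EReal.coe_mul_top_of_pos hb', EReal.add_top_of_ne_bot]
      · exact le_top
      · exact EReal.coe_mul_ne_bot ha hbx
    have h1 := H x y (h x).toReal (h y).toReal (EReal.coe_toReal hx hbx).ge
      (EReal.coe_toReal hy hby).ge a b ha hb' hab
    rw [← EReal.add_coe_le_coe_iff] at h1
    have h2 : ((a * (h x).toReal + b * (h y).toReal : ℝ) : EReal) = a * h x + b * h y := by
      rw [EReal.coe_add, EReal.coe_mul, EReal.coe_mul, EReal.coe_toReal hx hbx,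
        EReal.coe_toReal hy hby]
    rwa [h2] at h1

/-- A closed proper strongly convex function on a finite-dimensional space has a minimizer. -/
theorem exists_minimizer_of_stronglyConvexFun [FiniteDimensional ℝ E] {μ : ℝ} (hμ : 0 < μ)
    (hl : LowerSemicontinuous h) (hp : ProperFun h) (hc : StronglyConvexFun μ h) :
    ∃ u, ∀ v, h u ≤ h v := by
  obtain ⟨hb, x₀, hx₀⟩ := hp
  rw [stronglyConvexFun_iff hb] at hc
  have : ProperSpace E := FiniteDimensional.proper ℝ E
  obtain ⟨w, hw, hwmin⟩ := LowerSemicontinuousOn.exists_isMinOn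
    (s := Metric.closedBall x₀ 1) ⟨x₀, by simp⟩ (isCompact_closedBall _ _)
    (hl.lowerSemicontinuousOn _)
  have hwx : h w ≤ h x₀ := hwmin (by simp)
  obtain ⟨a, ha⟩ : ∃ a : ℝ, h x₀ = a := ⟨_, (EReal.coe_toReal hx₀ (hb _)).symm⟩
  obtain ⟨m, hm⟩ : ∃ m : ℝ, h w = m :=
    ⟨_, (EReal.coe_toReal (fun H => hx₀ (top_le_iff.1 (H ▸ hwx))) (hb _)).symm⟩
  have hma : m ≤ a := by rw [ha, hm] at hwx; exact_mod_cast hwx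
  -- If `v` lies at distance `r > 1` and has value below `a`, strong convexity at the point of the
  -- segment at distance `1` from `x₀`, where `h ≥ m`, forces `r < R`. Outside this ball `h` is thus
  -- at least `h x₀`.
  set R : ℝ := 1 + 2 * (a - m) / μ with hR
  have hR1 : 1 ≤ R := by
    have : 0 ≤ 2 * (a - m) / μ := div_nonneg (by linarith) hμ.le
    linarith
  obtain ⟨u, hu, humin⟩ := LowerSemicontinuousOn.exists_isMinOn
    (s := Metric.closedBall x₀ R) ⟨x₀, by simpa using by linarith⟩ (isCompact_closedBall _ _)
    (hl.lowerSemicontinuousOn _)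
  refine ⟨u, fun v => ?_⟩
  by_cases hv : v ∈ Metric.closedBall x₀ R
  · exact humin hv
  have hux : h u ≤ a := ha ▸ humin (by simpa using by linarith)
  refine hux.trans (EReal.coe_le_of_forall_le_coe fun s hs => ?_)
  by_contra! hsa
  rw [Metric.mem_closedBall, not_le, dist_eq_norm] at hv
  set r := ‖v - x₀‖ with hr
  have hr1 : 1 < r := by linarith
  have hr0 : 0 < r := by linarith
  have h1 := hc x₀ v a s ha.le hs (1 - 1 / r) (1 / r)
    (by rw [sub_pos, div_lt_one hr0]; exact hr1) (by positivity) (by ring)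
  have hin : (1 - 1 / r) • x₀ + (1 / r) • v ∈ Metric.closedBall x₀ 1 := by
    have : (1 - 1 / r) • x₀ + (1 / r) • v - x₀ = (1 / r) • (v - x₀) := by module
    rw [Metric.mem_closedBall, dist_eq_norm, this, norm_smul, ← hr,
      Real.norm_of_nonneg (by positivity)]
    field_simp
    rfl
  have h2 := (hwmin hin).trans h1
  rw [hm, EReal.coe_le_coe_iff, norm_sub_rev, ← hr] at h2
  have h3 : r * m ≤ (r - 1) * a + s - μ / 2 * (r - 1) * r := by
    calc r * m ≤ r * _ := mul_le_mul_of_nonneg_left h2 hr0.le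
      _ = _ := by field_simp
  have h4 : 2 * (a - m) < μ * (r - 1) := by
    have : 2 * (a - m) / μ < r - 1 := by linarith
    rwa [div_lt_iff₀' hμ] at this
  nlinarith

/-- `w` is a subgradient of `h` at `u`, where `h u` is finite. -/
def IsSubgradient (h : E → EReal) (u w : E) : Prop :=
  ∃ r : ℝ, h u = r ∧ ∀ (v : E) (s : ℝ), h v ≤ s → r + ⟪w, v - u⟫_ℝ ≤ s

theorem IsSubgradient.ne_bot {u w : E} (hw : IsSubgradient h u w) (v : E) : h v ≠ ⊥ := by
  obtain ⟨r, -, H⟩ := hw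
  intro hv
  have := H v (r + ⟪w, v - u⟫_ℝ - 1) (hv ▸ bot_le)
  linarith

/-- The strong subgradient inequality. -/
theorem IsSubgradient.strong {u w : E} (hw : IsSubgradient h u w) {μ : ℝ}
    (hc : StronglyConvexFun μ h) {r : ℝ} (hr : h u = r) {v : E} {s : ℝ} (hv : h v ≤ s) :
    r + ⟪w, v - u⟫_ℝ + μ / 2 * ‖v - u‖ ^ 2 ≤ s := by
  rw [stronglyConvexFun_iff hw.ne_bot] at hc
  obtain ⟨r', hr', H⟩ := hw
  obtain rfl : r = r' := by rw [hr] at hr'; exact_mod_cast hr'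
  -- The plain subgradient inequality at `(1 - t) u + t v`, divided by `t`; then `t → 0`.
  have key : ∀ t ∈ Set.Ioo (0 : ℝ) 1,
      r + ⟪w, v - u⟫_ℝ + μ / 2 * (1 - t) * ‖v - u‖ ^ 2 ≤ s := by
    rintro t ⟨ht0, ht1⟩
    have h1 := H _ _ (hc u v r s hr.le hv (1 - t) t (by linarith) ht0 (by ring))
    have h2 : (1 - t) • u + t • v - u = t • (v - u) := by module
    rw [h2, inner_smul_right, norm_sub_rev] at h1
    have h3 : t * (r + ⟪w, v - u⟫_ℝ + μ / 2 * (1 - t) * ‖v - u‖ ^ 2) ≤ t * s := by linarith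
    exact le_of_mul_le_mul_left h3 ht0
  have hlim : Filter.Tendsto (fun t : ℝ => r + ⟪w, v - u⟫_ℝ + μ / 2 * (1 - t) * ‖v - u‖ ^ 2)
      (𝓝[>] 0) (𝓝 (r + ⟪w, v - u⟫_ℝ + μ / 2 * (1 - 0) * ‖v - u‖ ^ 2)) :=
    ((by fun_prop : Continuous fun t : ℝ => r + ⟪w, v - u⟫_ℝ + μ / 2 * (1 - t) * ‖v - u‖ ^ 2).tendsto
      0).mono_left nhdsWithin_le_nhds
  rw [sub_zero, mul_one] at hlim
  refine le_of_tendsto hlim ?_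
  filter_upwards [Ioo_mem_nhdsGT (zero_lt_one' ℝ)] with t ht using key t ht

theorem IsSubgradient.strong_monotone {u w u' w' : E} (hw : IsSubgradient h u w)
    (hw' : IsSubgradient h u' w') {μ : ℝ} (hc : StronglyConvexFun μ h) :
    μ * ‖u - u'‖ ^ 2 ≤ ⟪w - w', u - u'⟫_ℝ := by
  obtain ⟨r, hr, -⟩ := id hw
  obtain ⟨r', hr', -⟩ := id hw'
  have h1 := hw.strong hc hr hr'.le
  have h2 := hw'.strong hc hr' hr.le
  rw [norm_sub_rev] at h1
  have h3 : ⟪w, u' - u⟫_ℝ = -⟪w, u - u'⟫_ℝ := by rw [← inner_neg_right, neg_sub]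
  rw [inner_sub_left]
  linarith

theorem IsSubgradient.of_coe_mul {γ : ℝ} (hγ : 0 < γ) {u w : E}
    (hw : IsSubgradient (fun v => (γ : EReal) * h v) u (γ • w)) : IsSubgradient h u w := by
  obtain ⟨r, hr, H⟩ := hw
  beta_reduce at hr
  have hr' : h u = ((r / γ : ℝ) : EReal) := by
    refine le_antisymm ((EReal.coe_mul_le_coe_iff hγ _ _).1 hr.le) ?_
    refine EReal.coe_le_of_forall_le_coe fun s hs => ?_
    have : (γ : EReal) * h u ≤ ((γ * s : ℝ) : EReal) := by
      rw [EReal.coe_mul_le_coe_iff hγ]; simpa [hγ.ne'] using hs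
    rw [div_le_iff₀' hγ]
    rw [hr] at this
    exact_mod_cast this
  refine ⟨r / γ, hr', fun v s hs => ?_⟩
  have h1 := H v (γ * s) (by rw [EReal.coe_mul_le_coe_iff hγ]; simpa [hγ.ne'] using hs)
  rw [inner_smul_left, conj_trivial] at h1
  have h2 : γ * (r / γ + ⟪w, v - u⟫_ℝ) ≤ γ * s := by
    rw [mul_add, mul_div_cancel₀ _ hγ.ne']; exact h1
  exact le_of_mul_le_mul_left h2 hγ

theorem IsSubgradient.coe_mul {γ : ℝ} (hγ : 0 < γ) {u w : E} (hw : IsSubgradient h u w) :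
    IsSubgradient (fun v => (γ : EReal) * h v) u (γ • w) := by
  obtain ⟨r, hr, H⟩ := hw
  refine ⟨γ * r, by simp [hr], fun v s hs => ?_⟩
  have h1 := H v (s / γ) ((EReal.coe_mul_le_coe_iff hγ _ _).1 hs)
  rw [inner_smul_left, conj_trivial, ← mul_add, ← le_div_iff₀' hγ]
  exact h1

/-- Closed, proper and `μ`-strongly convex functions. -/
structure IsClosedProperConvex (μ : ℝ) (h : E → EReal) : Prop where
  lsc : LowerSemicontinuous h
  proper : ProperFun h
  convex : StronglyConvexFun μ h

theorem IsClosedProperConvex.coe_mul {μ γ : ℝ} (hγ : 0 < γ) (H : IsClosedProperConvex μ h) :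
    IsClosedProperConvex (γ * μ) fun v => (γ : EReal) * h v := by
  have hb : ∀ x, (γ : EReal) * h x ≠ ⊥ := fun x => EReal.coe_mul_ne_bot hγ (H.proper.1 x)
  refine ⟨?_, ⟨hb, ?_⟩, ?_⟩
  · rw [lowerSemicontinuous_iff_isClosed_preimage]
    intro y
    induction y with
    | bot =>
      convert isClosed_empty
      ext x
      simpa using hb x
    | top => simp
    | coe y =>
      convert lowerSemicontinuous_iff_isClosed_preimage.1 H.lsc ((y / γ : ℝ) : EReal) using 1
      ext x
      exact EReal.coe_mul_le_coe_iff hγ _ _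
  · obtain ⟨x, hx⟩ := H.proper.2
    refine ⟨x, ?_⟩
    beta_reduce
    rw [← EReal.coe_toReal hx (H.proper.1 x), ← EReal.coe_mul]
    exact EReal.coe_ne_top _
  · have hc := H.convex
    rw [stronglyConvexFun_iff H.proper.1] at hc
    rw [stronglyConvexFun_iff hb]
    intro x y r s hr hs a b ha hb' hab
    rw [EReal.coe_mul_le_coe_iff hγ] at hr hs ⊢
    refine (hc x y _ _ hr hs a b ha hb' hab).trans (EReal.coe_le_coe_iff.2 (le_of_eq ?_))
    field_simp

/-- Fermat's rule for `h + ‖x - ·‖² / 2`, once a minimizer is known to exist, so that the choice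
operator in `prox` selects one. -/
theorem IsClosedProperConvex.isSubgradient_prox [FiniteDimensional ℝ E] {μ : ℝ} (hμ : 0 ≤ μ)
    (H : IsClosedProperConvex μ h) (x : E) : IsSubgradient h (prox h x) (x - prox h x) := by
  have hc := H.convex
  rw [stronglyConvexFun_iff H.proper.1] at hc
  set φ : E → EReal := fun u => h u + ((1 / 2 * ‖x - u‖ ^ 2 : ℝ) : EReal) with hφ
  have hφb : ∀ u, φ u ≠ ⊥ := fun u hu => by
    rcases EReal.add_eq_bot_iff.1 hu with h | h
    exacts [H.proper.1 u h, EReal.coe_ne_bot _ h]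
  have hid : ∀ (u v : E) (a b : ℝ), a + b = 1 → ‖x - (a • u + b • v)‖ ^ 2 =
      a * ‖x - u‖ ^ 2 + b * ‖x - v‖ ^ 2 - a * b * ‖u - v‖ ^ 2 := by
    intro u v a b hab
    have h1 : x - (a • u + b • v) = a • (x - u) + b • (x - v) := by
      have : x = (a + b) • x := by rw [hab, one_smul]
      nth_rewrite 1 [this]
      module
    have h2 : u - v = (x - v) - (x - u) := by abel
    obtain rfl : b = 1 - a := by linarith
    rw [h1, h2]
    generalize x - u = p
    generalize x - v = q
    rw [norm_add_sq_real, norm_sub_sq_real, norm_smul, norm_smul, inner_smul_left,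
      inner_smul_right, real_inner_comm q p, mul_pow, mul_pow, Real.norm_eq_abs, Real.norm_eq_abs, sq_abs, sq_abs,
      conj_trivial]
    ring
  have hmin : ∃ u, ∀ v, φ u ≤ φ v := by
    -- The modulus `1` comes from the quadratic term alone; `h` may be merely convex.
    refine exists_minimizer_of_stronglyConvexFun (μ := 1) one_pos ?_ ⟨hφb, ?_⟩ ?_
    · refine H.lsc.add' (Continuous.lowerSemicontinuous ?_) fun u =>
        EReal.continuousAt_add (.inr (EReal.coe_ne_bot _)) (.inr (EReal.coe_ne_top _))
      exact continuous_coe_real_ereal.comp (by fun_prop)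
    · obtain ⟨u, hu⟩ := H.proper.2
      exact ⟨u, by rw [hφ]; exact (EReal.add_lt_top hu (EReal.coe_ne_top _)).ne⟩
    · rw [stronglyConvexFun_iff hφb]
      intro u v r s hr hs a b ha hb hab
      simp only [hφ, EReal.add_coe_le_coe_iff] at hr hs ⊢
      refine (hc u v _ _ hr hs a b ha hb hab).trans (EReal.coe_le_coe_iff.2 ?_)
      rw [hid u v a b hab]
      have : 0 ≤ μ / 2 * (a * b) * ‖u - v‖ ^ 2 := by positivity
      linarith
  have hspec : ∀ v, φ (prox h x) ≤ φ v := Classical.epsilon_spec hmin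
  set u := prox h x
  have hu : h u ≠ ⊤ := by
    intro hu
    obtain ⟨v, hv⟩ := H.proper.2
    have h1 := hspec v
    simp only [hφ, hu, EReal.top_add_coe, top_le_iff] at h1
    exact (EReal.add_lt_top hv (EReal.coe_ne_top _)).ne h1
  refine ⟨(h u).toReal, (EReal.coe_toReal hu (H.proper.1 u)).symm, fun v s hs => ?_⟩
  set r := (h u).toReal
  have hr : h u = r := (EReal.coe_toReal hu (H.proper.1 u)).symm
  -- Minimality of `u` against `(1 - t) u + t v`: the quadratic leaves an error of order `t` after
  -- division by `t`.
  have key : ∀ t ∈ Set.Ioo (0 : ℝ) 1,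
      r + ⟪x - u, v - u⟫_ℝ ≤ s + t * (1 / 2 * ‖v - u‖ ^ 2) := by
    rintro t ⟨ht0, ht1⟩
    have h1 := hc u v r s hr.le hs (1 - t) t (by linarith) ht0 (by ring)
    have h2 := hspec ((1 - t) • u + t • v)
    have h3 : φ ((1 - t) • u + t • v) ≤ _ :=
      add_le_add_left h1 ((1 / 2 * ‖x - ((1 - t) • u + t • v)‖ ^ 2 : ℝ) : EReal)
    have h4 := h2.trans h3
    simp only [hφ, hr] at h4
    rw [← EReal.coe_add, ← EReal.coe_add, EReal.coe_le_coe_iff] at h4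
    have h5 : x - ((1 - t) • u + t • v) = (x - u) - t • (v - u) := by module
    rw [h5, norm_sub_sq_real (x - u), inner_smul_right, norm_smul, mul_pow, Real.norm_eq_abs,
      sq_abs] at h4
    have h6 : 0 ≤ μ / 2 * ((1 - t) * t) * ‖u - v‖ ^ 2 := by
      have : 0 ≤ 1 - t := by linarith
      positivity
    have h7 : t * (r + ⟪x - u, v - u⟫_ℝ) ≤ t * (s + t * (1 / 2 * ‖v - u‖ ^ 2)) := by linarith
    exact le_of_mul_le_mul_left h7 ht0
  have hlim : Filter.Tendsto (fun t : ℝ => s + t * (1 / 2 * ‖v - u‖ ^ 2))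
      (𝓝[>] 0) (𝓝 (s + 0 * (1 / 2 * ‖v - u‖ ^ 2))) :=
    ((by fun_prop : Continuous fun t : ℝ => s + t * (1 / 2 * ‖v - u‖ ^ 2)).tendsto
      0).mono_left nhdsWithin_le_nhds
  rw [zero_mul, add_zero] at hlim
  refine ge_of_tendsto hlim ?_
  filter_upwards [Ioo_mem_nhdsGT (zero_lt_one' ℝ)] with t ht using key t ht

theorem IsClosedProperConvex.eq_prox [FiniteDimensional ℝ E] {μ : ℝ} (hμ : 0 ≤ μ)
    (H : IsClosedProperConvex μ h) {x u : E} (hu : IsSubgradient h u (x - u)) : u = prox h x := by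
  have h1 := hu.strong_monotone (H.isSubgradient_prox hμ x) H.convex
  have h2 : x - u - (x - prox h x) = -(u - prox h x) := by abel
  rw [h2, inner_neg_left, real_inner_self_eq_norm_sq] at h1
  have h3 : 0 ≤ μ * ‖u - prox h x‖ ^ 2 := by positivity
  exact eq_of_mul_norm_sub_sq_nonpos (ρ := 2) two_pos (by linarith)

/-- Cocoercivity of the proximal operator. -/
theorem IsClosedProperConvex.prox_cocoercive [FiniteDimensional ℝ E] {μ : ℝ} (hμ : 0 ≤ μ)
    (H : IsClosedProperConvex μ h) (x x' : E) :
    (1 + μ) * ‖prox h x - prox h x'‖ ^ 2 ≤ ⟪prox h x - prox h x', x - x'⟫_ℝ := by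
  have h1 := (H.isSubgradient_prox hμ x).strong_monotone (H.isSubgradient_prox hμ x') H.convex
  have h2 : x - prox h x - (x' - prox h x') = (x - x') - (prox h x - prox h x') := by abel
  rw [h2, inner_sub_left, real_inner_self_eq_norm_sq, real_inner_comm] at h1
  linarith

/-! ### Conjugates -/

/-- The equality case of Fenchel–Young: the supremum defining the conjugate at `w` is attained at
`u`. -/
theorem IsSubgradient.fenchelConj {u w : E} (hw : IsSubgradient h u w) :
    IsSubgradient (fenchelConj h) w u := by
  have hb := hw.ne_bot
  obtain ⟨r, hr, H⟩ := hw
  have hle : ∀ v, ((⟪u, v⟫_ℝ - r : ℝ) : EReal) ≤ _root_.fenchelConj h v := fun v => by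
    refine le_trans ?_ (le_iSup _ u)
    rw [hr, EReal.coe_sub]
  refine ⟨⟪u, w⟫_ℝ - r, le_antisymm (iSup_le fun x => ?_) (hle w), fun v s hs => ?_⟩
  · rw [EReal.coe_sub_le_coe_iff (hb x)]
    refine EReal.coe_le_of_forall_le_coe fun s hs => ?_
    have := H x s hs
    rw [inner_sub_right, real_inner_comm x w, real_inner_comm u w] at this
    linarith
  · have := EReal.coe_le_coe_iff.1 ((hle v).trans hs)
    rw [inner_sub_right]
    linarith

/-- Semicontinuity is that of a supremum of affine functions. Properness comes from a subgradient of
the conjugate, obtained by swapping the one of `h` at `prox h 0`. -/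
theorem IsClosedProperConvex.fenchelConj [FiniteDimensional ℝ E] {μ ν : ℝ} (hμ : 0 ≤ μ)
    (H : IsClosedProperConvex μ h) (hc : StronglyConvexFun ν (fenchelConj h)) :
    IsClosedProperConvex ν (fenchelConj h) := by
  have hs := (H.isSubgradient_prox hμ 0).fenchelConj
  refine ⟨lowerSemicontinuous_iSup fun x => ?_, ⟨hs.ne_bot, ?_⟩, hc⟩
  · rcases eq_or_ne (h x) ⊤ with hx | hx
    · simp only [hx, EReal.sub_top]
      exact lowerSemicontinuous_const
    · rw [← EReal.coe_toReal hx (H.proper.1 x)]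
      simp only [← EReal.coe_sub]
      exact (continuous_coe_real_ereal.comp (by fun_prop)).lowerSemicontinuous
  · obtain ⟨r, hr, -⟩ := hs
    exact ⟨_, by rw [hr]; exact EReal.coe_ne_top r⟩

/-- Moreau's identity. -/
theorem IsClosedProperConvex.prox_fenchelConj [FiniteDimensional ℝ E] {μ ν : ℝ} (hμ : 0 ≤ μ)
    (hν : 0 ≤ ν) (H : IsClosedProperConvex μ h) (hc : StronglyConvexFun ν (_root_.fenchelConj h))
    (y : E) : prox (_root_.fenchelConj h) y = y - prox h y := by
  refine ((H.fenchelConj hμ hc).eq_prox hν ?_).symm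
  simpa using (H.isSubgradient_prox hμ y).fenchelConj

/-! ### Min-max problems -/

variable {Y : Type*} [NormedAddCommGroup Y] [InnerProductSpace ℝ Y]

/-- The second inclusion says that `y` attains the inner maximum at `x`; at any other `x'` the inner
maximum is bounded below by its value at this same `y`. -/
theorem isMinMaxSolution_of_isSubgradient [CompleteSpace E] [CompleteSpace Y] {fs : Y → EReal}
    {K : E →L[ℝ] Y} {x : E} {y : Y}
    (hx : IsSubgradient h x (-ContinuousLinearMap.adjoint K y)) (hy : IsSubgradient fs y (K x)) :
    IsMinMaxSolution h fs K (x, y) := by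
  have hyb := hy.ne_bot
  have hxb := hx.ne_bot
  obtain ⟨r, hr, Hx⟩ := hx
  obtain ⟨s, hs, Hy⟩ := hy
  have hinner : ∀ y', ((⟪K x, y'⟫_ℝ : ℝ) : EReal) - fs y' ≤ ((⟪K x, y⟫_ℝ - s : ℝ) : EReal) := by
    intro y'
    rw [EReal.coe_sub_le_coe_iff (hyb y')]
    refine EReal.coe_le_of_forall_le_coe fun q hq => ?_
    have := Hy y' q hq
    rw [inner_sub_right] at this
    linarith
  refine ⟨fun x' => ?_, fun y' => ?_⟩
  · calc h x + (⨆ y', ((⟪K x, y'⟫_ℝ : ℝ) : EReal) - fs y')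
        ≤ (r : EReal) + ((⟪K x, y⟫_ℝ - s : ℝ) : EReal) := add_le_add hr.le (iSup_le hinner)
      _ ≤ h x' + ((⟪K x', y⟫_ℝ - s : ℝ) : EReal) := by
        rw [← EReal.coe_add]
        refine EReal.coe_le_of_forall_le_coe fun q hq => ?_
        rw [EReal.add_coe_le_coe_iff] at hq
        have := Hx x' _ hq
        rw [inner_neg_left, ContinuousLinearMap.adjoint_inner_left, map_sub, inner_sub_right,
          real_inner_comm, real_inner_comm (K x) y] at this
        linarith
      _ ≤ h x' + (⨆ y', ((⟪K x', y'⟫_ℝ : ℝ) : EReal) - fs y') := by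
        gcongr
        refine le_trans ?_ (le_iSup _ y)
        rw [hs, EReal.coe_sub]
  · refine (hinner y').trans ?_
    simp only [hs, EReal.coe_sub]
    exact le_rfl

/-- Inserting the fixed `y` into the inner supremum at `x'` shows that `x'` does no worse than `x`
for `h + ⟨K ·, y⟩`, a strongly convex function minimized at `x`. With `x' = x`, both `y'` and `y`
maximize the same strongly concave function. -/
theorem IsMinMaxSolution.eq_of_isSubgradient [CompleteSpace E] [CompleteSpace Y] {fs : Y → EReal}
    {K : E →L[ℝ] Y} {x : E} {y : Y} {μ ν : ℝ} (hμ : 0 < μ) (hν : 0 < ν)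
    (hc : StronglyConvexFun μ h) (hcs : StronglyConvexFun ν fs)
    (hx : IsSubgradient h x (-ContinuousLinearMap.adjoint K y)) (hy : IsSubgradient fs y (K x))
    {z : E × Y} (hz : IsMinMaxSolution h fs K z) : z = (x, y) := by
  obtain ⟨x', y'⟩ := z
  have hsol := isMinMaxSolution_of_isSubgradient hx hy
  obtain ⟨r, hr, -⟩ := id hx
  obtain ⟨s, hs, -⟩ := id hy
  obtain rfl : x' = x := by
    have h1 : h x' + ((⟪K x', y⟫_ℝ - s : ℝ) : EReal) ≤ ((r + (⟪K x, y⟫_ℝ - s) : ℝ) : EReal) := by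
      calc h x' + ((⟪K x', y⟫_ℝ - s : ℝ) : EReal)
          ≤ h x' + (⨆ y', ((⟪K x', y'⟫_ℝ : ℝ) : EReal) - fs y') := by
            gcongr
            refine le_trans ?_ (le_iSup _ y)
            rw [hs, EReal.coe_sub]
        _ ≤ h x + (⨆ y', ((⟪K x, y'⟫_ℝ : ℝ) : EReal) - fs y') := hz.1 x
        _ ≤ r + ((⟪K x, y⟫_ℝ - s : ℝ) : EReal) :=
            add_le_add hr.le (iSup_le fun y' => by
              refine (hsol.2 y').trans ?_
              simp only [hs, EReal.coe_sub]
              exact le_rfl)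
        _ = _ := by rw [← EReal.coe_add]
    rw [EReal.add_coe_le_coe_iff] at h1
    have h2 := hx.strong hc hr h1
    rw [inner_neg_left, ContinuousLinearMap.adjoint_inner_left, map_sub, inner_sub_right,
      real_inner_comm, real_inner_comm (K x) y] at h2
    exact eq_of_mul_norm_sub_sq_nonpos hμ (by linarith)
  obtain rfl : y' = y := by
    have h1 := hz.2 y
    simp only [hs] at h1
    rw [← EReal.coe_sub, EReal.coe_le_coe_sub_iff] at h1
    have h2 := hy.strong hcs hs h1
    rw [inner_sub_right] at h2
    exact eq_of_mul_norm_sub_sq_nonpos hν (by linarith)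
  rfl

end

/-! ### Bounds on partial Clarke Jacobians -/

section

theorem IsConservativeJacobianOn.congr {E F : Type*} [NormedAddCommGroup E] [NormedSpace ℝ E]
    [NormedAddCommGroup F] [NormedSpace ℝ F] {U : Set E} {f : E → F}
    {J J' : E → Set (E →L[ℝ] F)} (h : IsConservativeJacobianOn U f J)
    (hJ : ∀ x ∈ U, J x = J' x) : IsConservativeJacobianOn U f J' where
  nonempty x hx := hJ x hx ▸ h.nonempty x hx
  locallyBounded x hx := by
    obtain ⟨C, N, hN, hC⟩ := h.locallyBounded x hx
    exact ⟨C, N, hN, fun y hy A hA => hC y hy A (hJ y hy.2 ▸ hA)⟩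
  closedGraph x hx A hA := by
    rw [← hJ x hx]
    refine h.closedGraph x hx A (closure_mono ?_ hA)
    rintro q ⟨hq, hqA⟩
    exact ⟨hq, hJ q.1 hq ▸ hqA⟩
  chainRule c hc hcU := by
    have hmem : ∀ᵐ t ∂(MeasureTheory.volume.restrict (Set.Icc (0 : ℝ) 1)),
        t ∈ Set.Icc (0 : ℝ) 1 := MeasureTheory.ae_restrict_mem measurableSet_Icc
    filter_upwards [h.chainRule c hc hcU, hmem] with t ht htm A hA
    exact ht A (hJ _ (hcU t htm) ▸ hA)

variable {P Z F H : Type*} [NormedAddCommGroup P] [NormedSpace ℝ P]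
  [NormedAddCommGroup Z] [NormedSpace ℝ Z] [NormedAddCommGroup F] [NormedSpace ℝ F]
  [NormedAddCommGroup H] [NormedSpace ℝ H]

/-- Positively homogeneous convex bounds on increments in the second variable carry over to the
Clarke Jacobian. -/
theorem norm_clarkeJacobian_apply_inr_le {Θ : Set P} (hΘ : IsOpen Θ) {f : P × Z → F}
    (Λ : F × Z →L[ℝ] H) {r : Z → ℝ} (hr : ∀ k, ∀ t : ℝ, 0 < t → r (t • k) = t * r k)
    (hf : ∀ θ ∈ Θ, ∀ x k, ‖Λ (f (θ, x + k) - f (θ, x), k)‖ ≤ r k) {q : P × Z} (hq : q.1 ∈ Θ)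
    {M : P × Z →L[ℝ] F} (hM : M ∈ clarkeJacobian f q) (k : Z) : ‖Λ (M (0, k), k)‖ ≤ r k := by
  -- For fixed `k` the estimate is a closed convex condition on `M`, so difference quotients in the
  -- direction `(0, k)` at differentiability points suffice.
  have hsub : clarkeJacobian f q ⊆ {M | ‖Λ (M (0, k), k)‖ ≤ r k} := by
    refine clarkeJacobian_subset ?_ (isClosed_le (by fun_prop) continuous_const) ?_
    · intro A hA B hB a b ha hb hab
      simp only [Set.mem_ofPred_eq] at hA hB ⊢
      have h1 : ((a • A + b • B) (0, k), k) = a • (A (0, k), k) + b • (B (0, k), k) := by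
        simp [← add_smul, hab]
      rw [h1, map_add, map_smul, map_smul]
      calc ‖a • Λ (A (0, k), k) + b • Λ (B (0, k), k)‖
          ≤ a * ‖Λ (A (0, k), k)‖ + b * ‖Λ (B (0, k), k)‖ := by
            refine (norm_add_le _ _).trans_eq ?_
            rw [norm_smul, norm_smul, Real.norm_of_nonneg ha, Real.norm_of_nonneg hb]
        _ ≤ a * r k + b * r k := by gcongr
        _ = r k := by rw [← add_mul, hab, one_mul]
    · have hev : ∀ᶠ y : P × Z in 𝓝 q, y.1 ∈ Θ :=
        continuous_fst.continuousAt.eventually_mem (hΘ.mem_nhds hq)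
      filter_upwards [hev] with y hy hd
      have h1 : HasDerivAt (fun t : ℝ => f (y + t • ((0 : P), k))) (fderiv ℝ f y (0, k)) 0 := by
        have h1 : HasDerivAt (fun t : ℝ => y + t • ((0 : P), k)) ((0 : P), k) 0 := by
          simpa using ((hasDerivAt_id (0 : ℝ)).smul_const ((0 : P), k)).const_add y
        have h2 : HasFDerivAt f (fderiv ℝ f y) (y + (0 : ℝ) • ((0 : P), k)) := by
          simpa using hd.hasFDerivAt
        exact h2.comp_hasDerivAt 0 h1
      have h2 := h1.tendsto_slope_zero_right
      have hΛ : Continuous fun w : F => ‖Λ (w, k)‖ := by fun_prop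
      refine le_of_tendsto ((hΛ.tendsto _).comp h2) ?_
      filter_upwards [self_mem_nhdsWithin] with t ht
      have ht : 0 < t := ht
      have h3 := hf y.1 hy y.2 (t • k)
      rw [hr k t ht] at h3
      simp only [Function.comp_apply, zero_add, zero_smul, add_zero]
      have h4 : (t⁻¹ • (f (y + t • ((0 : P), k)) - f y), k) =
          t⁻¹ • (f (y.1, y.2 + t • k) - f (y.1, y.2), t • k) := by
        have h5 : y + t • ((0 : P), k) = (y.1, y.2 + t • k) := by ext <;> simp
        rw [h5, Prod.smul_mk, inv_smul_smul₀ ht.ne']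
      rw [h4, map_smul, norm_smul, Real.norm_of_nonneg (by positivity), inv_mul_le_iff₀ ht]
      exact h3
  exact hsub hM

theorem ContinuousLinearMap.isInvertible_of_injective [FiniteDimensional ℝ Z] (S : Z →L[ℝ] Z)
    (hS : ∀ k, S k = 0 → k = 0) : S.IsInvertible := by
  have hinj : Function.Injective (S : Z →ₗ[ℝ] Z) :=
    (injective_iff_map_eq_zero _).2 hS
  refine ⟨(LinearEquiv.ofInjectiveEndo (S : Z →ₗ[ℝ] Z) hinj).toContinuousLinearEquiv, ?_⟩
  ext x
  rfl

end

/-! ### Rescaling of parametric proximal maps -/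

section

/-- Here `e` is the increment of a firmly nonexpansive map under the displacement `s d`. For `s ≤ 0`
it makes no acute angle with `d`, and for `s > 0` it is at most `s ‖d‖`. Nonexpansiveness alone
would not handle very negative `s`, which small step sizes produce. -/
theorem norm_le_of_cocoercive {X : Type*} [NormedAddCommGroup X] [InnerProductSpace ℝ X] {s : ℝ}
    {d e : X} (h : ‖e‖ ^ 2 ≤ s * ⟪e, d⟫_ℝ) : (1 - max s 0) * ‖d‖ ≤ ‖d - e‖ := by
  have h1 : ⟪e, d⟫_ℝ ≤ max s 0 * ‖d‖ ^ 2 := by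
    rcases le_or_gt s 0 with hs | hs
    · rw [max_eq_right hs, zero_mul]
      by_contra! hcon
      have h2 : ‖e‖ ^ 2 ≤ 0 := h.trans (mul_nonpos_of_nonpos_of_nonneg hs hcon.le)
      have h3 : e = 0 := by
        have := pow_eq_zero_iff two_ne_zero |>.1 (le_antisymm h2 (sq_nonneg ‖e‖))
        exact norm_eq_zero.1 this
      simp [h3] at hcon
    · rw [max_eq_left hs.le]
      have h2 := real_inner_le_norm e d
      have h3 : ‖e‖ ≤ s * ‖d‖ := by
        rcases (norm_nonneg e).eq_or_lt with he | he
        · rw [← he]; positivity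
        · have : ‖e‖ * ‖e‖ ≤ ‖e‖ * (s * ‖d‖) := by nlinarith
          exact le_of_mul_le_mul_left this he
      nlinarith [norm_nonneg d]
  have h2 : (1 - max s 0) * ‖d‖ ^ 2 ≤ ‖d - e‖ * ‖d‖ := by
    have := real_inner_le_norm (d - e) d
    rw [inner_sub_left, real_inner_self_eq_norm_sq] at this
    linarith
  rcases (norm_nonneg d).eq_or_lt with hd | hd
  · rw [← hd, mul_zero]; exact norm_nonneg _
  · refine le_of_mul_le_mul_right ?_ hd
    linarith

variable {P X : Type*} [NormedAddCommGroup P] [NormedSpace ℝ P] [FiniteDimensional ℝ P]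
  [NormedAddCommGroup X] [InnerProductSpace ℝ X] [FiniteDimensional ℝ X]

theorem proxMap_eq_iff {h : X → EReal} {μ γ : ℝ} (hμ : 0 ≤ μ) (hγ : 0 < γ)
    (H : IsClosedProperConvex μ h) {x u : X} :
    prox (fun v => (γ : EReal) * h v) x = u ↔ IsSubgradient h u (γ⁻¹ • (x - u)) := by
  have Hγ := H.coe_mul hγ
  have hμγ : 0 ≤ γ * μ := by positivity
  constructor
  · rintro rfl
    refine IsSubgradient.of_coe_mul hγ ?_
    rw [smul_inv_smul₀ hγ.ne']
    exact Hγ.isSubgradient_prox hμγ x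
  · intro hu
    refine (Hγ.eq_prox hμγ ?_).symm
    have := hu.coe_mul hγ
    rwa [smul_inv_smul₀ hγ.ne'] at this

/-- Path differentiability of a parametric proximal map does not depend on the step size. -/
theorem PathDifferentiableOn.proxMap {Θ : Set P} (hΘ : IsOpen Θ) {h : P → X → EReal} {μ γ : ℝ}
    (hμ : 0 ≤ μ) (hγ : 0 < γ) (H : ∀ θ ∈ Θ, IsClosedProperConvex μ (h θ))
    (hp : PathDifferentiableOn (Θ ×ˢ (Set.univ : Set X)) fun q : P × X => prox (h q.1) q.2) :
    PathDifferentiableOn (Θ ×ˢ (Set.univ : Set X)) (_root_.proxMap γ h) := by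
  -- From `γ⁻¹ (x - u) ∈ ∂h(u)`, adding `u` gives `u = prox_h(γ⁻¹ x + s u)`. The map `L` below sends
  -- `((θ, x), u)` to `(θ, γ⁻¹ x + s u)`.
  set s : ℝ := 1 - γ⁻¹ with hs
  have hs1 : max s 0 < 1 := max_lt (by have := inv_pos.2 hγ; linarith) one_pos
  set U : Set (P × X) := Θ ×ˢ Set.univ
  have hU : IsOpen U := hΘ.prod isOpen_univ
  let L : (P × X) × X →L[ℝ] P × X :=
    (ContinuousLinearMap.fst ℝ P X ∘L ContinuousLinearMap.fst ℝ (P × X) X).prod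
      (γ⁻¹ • (ContinuousLinearMap.snd ℝ P X ∘L ContinuousLinearMap.fst ℝ (P × X) X) +
        s • ContinuousLinearMap.snd ℝ (P × X) X)
  have hLm : Set.MapsTo L (U ×ˢ (Set.univ : Set X)) U := fun q hq => ⟨hq.1.1, Set.mem_univ _⟩
  have hLlip : LocallyLipschitzOn (U ×ˢ (Set.univ : Set X)) L :=
    L.lipschitz.locallyLipschitz.locallyLipschitzOn
  have hJ := (hp.isConservativeJacobianOn_clarkeJacobian hU).sub_comp
    (L.isConservativeJacobianOn (U ×ˢ (Set.univ : Set X))) hLlip hLm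
    (ContinuousLinearMap.snd ℝ (P × X) X)
  have hRlip : LocallyLipschitzOn (U ×ˢ (Set.univ : Set X)) fun q : (P × X) × X =>
      ContinuousLinearMap.snd ℝ (P × X) X q - prox (h (L q).1) (L q).2 :=
    (ContinuousLinearMap.snd ℝ (P × X) X).lipschitz.locallyLipschitz.locallyLipschitzOn.sub
      (hp.1.comp_of_mapsTo hLlip hLm)
  have hcoc : ∀ θ ∈ Θ, ∀ x x',
      ‖prox (h θ) x - prox (h θ) x'‖ ^ 2 ≤ ⟪prox (h θ) x - prox (h θ) x', x - x'⟫_ℝ := by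
    intro θ hθ x x'
    refine le_trans ?_ ((H θ hθ).prox_cocoercive hμ x x')
    nlinarith [sq_nonneg ‖prox (h θ) x - prox (h θ) x'‖]
  have hz : ∀ q ∈ U, ContinuousLinearMap.snd ℝ (P × X) X (q, _root_.proxMap γ h q) -
      prox (h (L (q, _root_.proxMap γ h q)).1) (L (q, _root_.proxMap γ h q)).2 = 0 := by
    intro q hq
    have h1 : IsSubgradient (h q.1) (_root_.proxMap γ h q) (γ⁻¹ • (q.2 - _root_.proxMap γ h q)) :=
      (proxMap_eq_iff hμ hγ (H q.1 hq.1)).1 rfl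
    change _root_.proxMap γ h q - prox (h q.1) (γ⁻¹ • q.2 + s • _root_.proxMap γ h q) = 0
    rw [sub_eq_zero]
    refine (H q.1 hq.1).eq_prox hμ ?_
    have h2 : γ⁻¹ • q.2 + s • _root_.proxMap γ h q - _root_.proxMap γ h q =
        γ⁻¹ • (q.2 - _root_.proxMap γ h q) := by
      rw [hs]
      module
    rwa [h2]
  have hlip : LocallyLipschitzOn U (_root_.proxMap γ h) := by
    refine locallyLipschitzOn_of_implicit hRlip (C := ((1 - max s 0)⁻¹).toNNReal) ?_ hz
    · intro q hq u u'
      have h1 := hcoc q.1 hq.1 (γ⁻¹ • q.2 + s • u) (γ⁻¹ • q.2 + s • u')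
      rw [add_sub_add_left_eq_sub, ← smul_sub, inner_smul_right] at h1
      have h2 := norm_le_of_cocoercive h1
      rw [dist_eq_norm, dist_eq_norm, Real.coe_toNNReal _ (inv_nonneg.2 (by linarith))]
      rw [le_inv_mul_iff₀ (by linarith)]
      refine h2.trans_eq ?_
      congr 1
      change _ = (u - prox (h q.1) (γ⁻¹ • q.2 + s • u)) - (u' - prox (h q.1) (γ⁻¹ • q.2 + s • u'))
      abel
  refine ⟨hlip, _, hJ.implicit hlip hz ?_⟩
  rintro q hq _ ⟨M, hM, N, rfl, rfl⟩
  refine ContinuousLinearMap.isInvertible_of_injective _ fun k hk => ?_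
  have hq' : (L (q, _root_.proxMap γ h q)).1 ∈ Θ := hq.1
  -- Firm nonexpansiveness means that `e` lies in the ball with centre `k / 2` and radius `‖k‖ / 2`;
  -- in this form it is convex and passes to the Clarke Jacobian.
  have hball : ∀ e k : X, ‖e - (1 / 2 : ℝ) • k‖ ≤ 1 / 2 * ‖k‖ ↔ ‖e‖ ^ 2 ≤ ⟪e, k⟫_ℝ := by
    intro e k
    rw [← sq_le_sq₀ (norm_nonneg _) (by positivity), norm_sub_sq_real, norm_smul,
      inner_smul_right, mul_pow, mul_pow, Real.norm_of_nonneg (by norm_num)]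
    constructor <;> intro h <;> linarith
  have hV : ∀ k : X, ‖M (0, k)‖ ^ 2 ≤ ⟪M (0, k), k⟫_ℝ := by
    intro k
    refine (hball _ _).1 (norm_clarkeJacobian_apply_inr_le hΘ
      (Λ := ContinuousLinearMap.fst ℝ X X - (1 / 2 : ℝ) • ContinuousLinearMap.snd ℝ X X)
      (r := fun k => 1 / 2 * ‖k‖) ?_ ?_ hq' hM k)
    · intro k t ht
      rw [norm_smul, Real.norm_of_nonneg ht.le]
      ring
    · intro θ hθ x k
      refine (hball _ _).2 ?_
      simpa using hcoc θ hθ (x + k) x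
  have h1 := hV (s • k)
  rw [inner_smul_right] at h1
  have h2 := norm_le_of_cocoercive h1
  have h3 : k - M (0, s • k) = 0 := by
    rw [← hk]
    simp [partialSnd, L]
  rw [h3, norm_zero] at h2
  have h4 : ‖k‖ ≤ 0 := by
    by_contra! hcon
    have : 0 < (1 - max s 0) * ‖k‖ := mul_pos (by linarith) hcon
    linarith
  exact norm_le_zero_iff.1 h4

end

/-! ### Further calculus of path differentiable maps, and the coupling term. -/

section

theorem PathDifferentiableOn.congr {E F : Type*} [NormedAddCommGroup E] [NormedSpace ℝ E]
    [NormedAddCommGroup F] [NormedSpace ℝ F] {U : Set E} {f f' : E → F}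
    (h : PathDifferentiableOn U f) (hff' : Set.EqOn f f' U) : PathDifferentiableOn U f' := by
  obtain ⟨hlip, J, hJ⟩ := h
  refine ⟨fun x hx => ?_, J, hJ.nonempty, hJ.locallyBounded, hJ.closedGraph, fun c hc hcU => ?_⟩
  · obtain ⟨K, t, ht, hK⟩ := hlip hx
    refine ⟨K, t ∩ U, Filter.inter_mem ht self_mem_nhdsWithin, fun y hy y' hy' => ?_⟩
    rw [← hff' hy.2, ← hff' hy'.2]
    exact hK hy.1 hy'.1
  · filter_upwards [hJ.chainRule c hc hcU, ae_restrict_Icc_mem_Ioo] with t ht htm A hA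
    refine (ht A hA).congr_of_eventuallyEq ?_
    filter_upwards [Ioo_mem_nhds htm.1 htm.2] with s hs
    exact (hff' (hcU s ⟨hs.1.le, hs.2.le⟩)).symm

theorem PathDifferentiableOn.clm_sub {E F : Type*} [NormedAddCommGroup E] [NormedSpace ℝ E]
    [FiniteDimensional ℝ E] [NormedAddCommGroup F] [NormedSpace ℝ F] [FiniteDimensional ℝ F]
    {U : Set E} {f : E → F} (h : PathDifferentiableOn U f) (hU : IsOpen U) (ℓ : E →L[ℝ] F) :
    PathDifferentiableOn U fun x => ℓ x - f x :=
  ⟨ℓ.lipschitz.locallyLipschitz.locallyLipschitzOn.sub h.1, _,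
    (h.isConservativeJacobianOn_clarkeJacobian hU).sub_comp
      ((ContinuousLinearMap.id ℝ E).isConservativeJacobianOn U)
      LocallyLipschitz.id.locallyLipschitzOn (Set.mapsTo_id U) ℓ⟩

/-- The partial Clarke Jacobian in the linear variable of `(θ, z) ↦ b (K θ) z`. -/
theorem clarkeJacobian_bilinear_apply_inr {P F Z G : Type*} [NormedAddCommGroup P]
    [NormedSpace ℝ P] [NormedAddCommGroup F] [NormedSpace ℝ F] [NormedAddCommGroup Z]
    [NormedSpace ℝ Z] [NormedAddCommGroup G] [NormedSpace ℝ G] {Θ : Set P} (hΘ : IsOpen Θ)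
    {K : P → F} (hK : ContinuousOn K Θ) (b : F →L[ℝ] Z →L[ℝ] G) {q : P × Z} (hq : q.1 ∈ Θ)
    {N : P × Z →L[ℝ] G} (hN : N ∈ clarkeJacobian (fun q : P × Z => b (K q.1) q.2) q) (k : Z) :
    N (0, k) = b (K q.1) k := by
  refine eq_of_forall_dist_le fun ε hε => ?_
  -- At a differentiability point `y` the partial derivative is exactly `b (K y.1)`, and by
  -- continuity of `K` this is within `ε` of the value at `q` when applied to `k`.
  have hsub : clarkeJacobian (fun q : P × Z => b (K q.1) q.2) q ⊆
      (fun N : P × Z →L[ℝ] G => N (0, k)) ⁻¹' Metric.closedBall (b (K q.1) k) ε := by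
    refine clarkeJacobian_subset ?_ (Metric.isClosed_closedBall.preimage (by fun_prop)) ?_
    · exact (convex_closedBall _ ε).is_linear_preimage
        (f := fun N : P × Z →L[ℝ] G => N (0, k)) ⟨fun _ _ => rfl, fun _ _ => rfl⟩
    · have hev : ∀ᶠ y : P × Z in 𝓝 q, y.1 ∈ Θ :=
        continuous_fst.continuousAt.eventually_mem (hΘ.mem_nhds hq)
      have hcont : ContinuousAt (fun y : P × Z => b (K y.1) k) q := by
        have h1 : ContinuousAt (fun y : P × Z => K y.1) q :=
          (hK.continuousAt (hΘ.mem_nhds hq)).comp continuous_fst.continuousAt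
        exact (b.continuous.continuousAt.comp h1).clm_apply continuousAt_const
      filter_upwards [hev, hcont.eventually_mem (Metric.closedBall_mem_nhds _ hε)]
        with y hy hyε hd
      have h1 : HasDerivAt (fun t : ℝ => y + t • ((0 : P), k)) ((0 : P), k) 0 := by
        simpa using ((hasDerivAt_id (0 : ℝ)).smul_const ((0 : P), k)).const_add y
      have h2 : HasFDerivAt (fun q : P × Z => b (K q.1) q.2)
          (fderiv ℝ (fun q : P × Z => b (K q.1) q.2) y) (y + (0 : ℝ) • ((0 : P), k)) := by
        simpa using hd.hasFDerivAt
      have h3 := h2.comp_hasDerivAt 0 h1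
      have h4 : HasDerivAt (fun t : ℝ => b (K y.1) (y.2 + t • k)) (b (K y.1) k) 0 := by
        refine (b (K y.1)).hasFDerivAt.comp_hasDerivAt 0 ?_
        simpa using ((hasDerivAt_id (0 : ℝ)).smul_const k).const_add y.2
      have h5 : (fun q : P × Z => b (K q.1) q.2) ∘ (fun t : ℝ => y + t • ((0 : P), k)) =
          fun t : ℝ => b (K y.1) (y.2 + t • k) := by
        ext1 t
        simp
      rw [h5] at h3
      rw [Set.mem_preimage, h3.unique h4]
      exact hyε
  exact hsub hN

/-! ### The residual of the primal-dual problem -/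

variable {P X Y : Type*} [NormedAddCommGroup P] [NormedSpace ℝ P] [FiniteDimensional ℝ P]
  [NormedAddCommGroup X] [InnerProductSpace ℝ X] [FiniteDimensional ℝ X] [CompleteSpace X]
  [NormedAddCommGroup Y] [InnerProductSpace ℝ Y] [FiniteDimensional ℝ Y] [CompleteSpace Y]

/-- The bilinear map `(K, (x, y)) ↦ (K* y, - K x)`. -/
def couplingBilinear (X Y : Type*) [NormedAddCommGroup X] [InnerProductSpace ℝ X]
    [FiniteDimensional ℝ X] [CompleteSpace X] [NormedAddCommGroup Y] [InnerProductSpace ℝ Y]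
    [FiniteDimensional ℝ Y] [CompleteSpace Y] : (X →L[ℝ] Y) →L[ℝ] X × Y →L[ℝ] X × Y :=
  LinearMap.toContinuousLinearMap
    { toFun := fun K => (ContinuousLinearMap.adjoint K ∘L ContinuousLinearMap.snd ℝ X Y).prod
        (-(K ∘L ContinuousLinearMap.fst ℝ X Y))
      map_add' := fun K K' => by ext x <;> simp [add_comm]
      map_smul' := fun c K => by ext x <;> simp }

omit [NormedAddCommGroup P] [NormedSpace ℝ P] [FiniteDimensional ℝ P] in
theorem couplingMap_eq (K : P → X →L[ℝ] Y) :
    couplingMap K = fun q : P × (X × Y) => couplingBilinear X Y (K q.1) q.2 :=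
  rfl

theorem couplingBilinear_apply (K : X →L[ℝ] Y) (k : X × Y) :
    couplingBilinear X Y K k = (ContinuousLinearMap.adjoint K k.2, -K k.1) :=
  rfl

theorem PathDifferentiableOn.couplingMap {Θ : Set P} {K : P → X →L[ℝ] Y}
    (hK : PathDifferentiableOn Θ K) :
    PathDifferentiableOn (Θ ×ˢ (Set.univ : Set (X × Y))) (_root_.couplingMap K) := by
  rw [couplingMap_eq]
  exact hK.bilinear (couplingBilinear X Y)

omit [FiniteDimensional ℝ P] in
theorem clarkeJacobian_couplingMap_apply_inr {Θ : Set P} (hΘ : IsOpen Θ) {K : P → X →L[ℝ] Y}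
    (hK : ContinuousOn K Θ) {q : P × (X × Y)} (hq : q.1 ∈ Θ) {N : P × (X × Y) →L[ℝ] X × Y}
    (hN : N ∈ clarkeJacobian (couplingMap K) q) (k : X × Y) :
    N (0, k) = couplingBilinear X Y (K q.1) k :=
  clarkeJacobian_bilinear_apply_inr hΘ hK (couplingBilinear X Y) hq hN k

/-! ### Contraction estimates -/

theorem norm_sq_toLp {X Y : Type*} [NormedAddCommGroup X] [NormedAddCommGroup Y] (k : X × Y) : ‖WithLp.toLp 2 k‖ ^ 2 = ‖k.1‖ ^ 2 + ‖k.2‖ ^ 2 :=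
  WithLp.prod_norm_sq_eq_of_L2 _

/-- By skewness, the cross terms `⟨x, K* y⟩` and `⟨K x, y⟩` cancel, which gives `1 + γ²β²` instead
of `(1 + γβ)²`. -/
theorem norm_toLp_sub_coupling_sq_le {K : X →L[ℝ] Y} {β : ℝ} (hK : ‖K‖ ≤ β) (γ : ℝ) (k : X × Y) :
    ‖WithLp.toLp 2 (k - γ • couplingBilinear X Y K k)‖ ^ 2 ≤
      (1 + γ ^ 2 * β ^ 2) * ‖WithLp.toLp 2 k‖ ^ 2 := by
  obtain ⟨x, y⟩ := k
  rw [norm_sq_toLp, norm_sq_toLp, couplingBilinear_apply]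
  simp only [Prod.smul_mk, Prod.mk_sub_mk, smul_neg, sub_neg_eq_add]
  rw [norm_sub_sq_real, norm_add_sq_real, norm_smul, norm_smul, mul_pow, mul_pow, Real.norm_eq_abs,
    sq_abs, inner_smul_right, inner_smul_right, ContinuousLinearMap.adjoint_inner_right,
    real_inner_comm]
  have h1 : ‖ContinuousLinearMap.adjoint K y‖ ^ 2 ≤ β ^ 2 * ‖y‖ ^ 2 := by
    rw [← mul_pow]
    refine pow_le_pow_left₀ (norm_nonneg _) ?_ 2
    refine (ContinuousLinearMap.le_opNorm _ _).trans ?_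
    rw [LinearIsometryEquiv.norm_map]
    gcongr
  have h2 : ‖K x‖ ^ 2 ≤ β ^ 2 * ‖x‖ ^ 2 := by
    rw [← mul_pow]
    refine pow_le_pow_left₀ (norm_nonneg _) ?_ 2
    refine (ContinuousLinearMap.le_opNorm _ _).trans ?_
    gcongr
  have h3 := mul_le_mul_of_nonneg_left h1 (sq_nonneg γ)
  have h4 := mul_le_mul_of_nonneg_left h2 (sq_nonneg γ)
  linarith

theorem norm_toLp_sub_coupling_le {K : X →L[ℝ] Y} {β : ℝ} (hK : ‖K‖ ≤ β) (γ : ℝ) (k : X × Y) :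
    ‖WithLp.toLp 2 (k - γ • couplingBilinear X Y K k)‖ ≤
      √(1 + γ ^ 2 * β ^ 2) * ‖WithLp.toLp 2 k‖ := by
  rw [← sq_le_sq₀ (norm_nonneg _) (by positivity), mul_pow, Real.sq_sqrt (by positivity)]
  exact norm_toLp_sub_coupling_sq_le hK γ k

theorem norm_toLp_le_of_components {X Y : Type*} [NormedAddCommGroup X] [NormedAddCommGroup Y]
    {ρ : ℝ} (hρ : 0 ≤ ρ) {e k : X × Y} (h1 : ‖e.1‖ ≤ ρ * ‖k.1‖)
    (h2 : ‖e.2‖ ≤ ρ * ‖k.2‖) : ‖WithLp.toLp 2 e‖ ≤ ρ * ‖WithLp.toLp 2 k‖ := by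
  rw [← sq_le_sq₀ (norm_nonneg _) (by positivity), mul_pow, WithLp.prod_norm_sq_eq_of_L2,
    WithLp.prod_norm_sq_eq_of_L2, mul_add, ← mul_pow, ← mul_pow]
  exact add_le_add (pow_le_pow_left₀ (norm_nonneg _) h1 2) (pow_le_pow_left₀ (norm_nonneg _) h2 2)

/-- After squaring, the claim is `γ (β² - α²) < 2α`, which is weaker than `γ (α + β)² < 2α`. -/
theorem contraction_factor_lt_one {α β γ : ℝ} (hα : 0 < α) (hβ : 0 < β)
    (hγ : γ ∈ Set.Ioo 0 (2 * α / (α + β) ^ 2)) :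
    (1 + γ * α)⁻¹ * √(1 + γ ^ 2 * β ^ 2) < 1 := by
  obtain ⟨h0, h1⟩ := hγ
  rw [lt_div_iff₀ (by positivity)] at h1
  rw [inv_mul_lt_iff₀ (by positivity), mul_one, Real.sqrt_lt' (by positivity)]
  have h2 : 0 < γ * (α * β) := by positivity
  have h3 : 0 < γ * α ^ 2 := by positivity
  have h4 : γ * β ^ 2 < 2 * α + γ * α ^ 2 := by nlinarith
  nlinarith [mul_lt_mul_of_pos_left h4 h0]

theorem eq_zero_of_norm_le_mul {V : Type*} [NormedAddCommGroup V] {κ : ℝ} (hκ : κ < 1) {v : V}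
    (h : ‖v‖ ≤ κ * ‖v‖) : v = 0 := by
  by_contra hv
  have : 0 < ‖v‖ := norm_pos_iff.2 hv
  nlinarith

/-! ### Proximal maps of strongly convex functions are contractions -/

-- Cocoercivity for `γ h`, whose modulus is `γ α`, combined with Cauchy–Schwarz.
omit [NormedAddCommGroup P] [NormedSpace ℝ P] [FiniteDimensional ℝ P] [CompleteSpace X] in
theorem norm_proxMap_sub_le {h : P → X → EReal} {α γ : ℝ} (hα : 0 ≤ α) (hγ : 0 < γ) {θ : P}
    (H : IsClosedProperConvex α (h θ)) (x x' : X) :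
    ‖proxMap γ h (θ, x) - proxMap γ h (θ, x')‖ ≤ (1 + γ * α)⁻¹ * ‖x - x'‖ := by
  have h1 := (H.coe_mul hγ).prox_cocoercive (by positivity) x x'
  change (1 + γ * α) * ‖proxMap γ h (θ, x) - proxMap γ h (θ, x')‖ ^ 2 ≤
    ⟪proxMap γ h (θ, x) - proxMap γ h (θ, x'), x - x'⟫_ℝ at h1
  have h2 := h1.trans (real_inner_le_norm _ _)
  rw [le_inv_mul_iff₀ (by positivity)]
  rcases (norm_nonneg (proxMap γ h (θ, x) - proxMap γ h (θ, x'))).eq_or_lt with he | he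
  · rw [← he, mul_zero]; exact norm_nonneg _
  · refine le_of_mul_le_mul_left ?_ he
    linarith

omit [NormedAddCommGroup P] [NormedSpace ℝ P] [FiniteDimensional ℝ P] [CompleteSpace X] [CompleteSpace Y] in
theorem norm_toLp_backwardMap_sub_le {g : P → X → EReal} {fs : P → Y → EReal} {α γ : ℝ}
    (hα : 0 ≤ α) (hγ : 0 < γ) {θ : P} (hg : IsClosedProperConvex α (g θ))
    (hfs : IsClosedProperConvex α (fs θ)) (z z' : X × Y) :
    ‖WithLp.toLp 2 (backwardMap γ g fs (θ, z) - backwardMap γ g fs (θ, z'))‖ ≤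
      (1 + γ * α)⁻¹ * ‖WithLp.toLp 2 (z - z')‖ :=
  norm_toLp_le_of_components (by positivity) (norm_proxMap_sub_le hα hγ hg _ _)
    (norm_proxMap_sub_le hα hγ hfs _ _)

/-! ### Fixed points and solutions -/

/-- The forward-backward map `z ↦ T(θ, z - γ B(θ, z))`. -/
def forwardBackward (γ : ℝ) (g : P → X → EReal) (fs : P → Y → EReal) (K : P → X →L[ℝ] Y)
    (q : P × (X × Y)) : X × Y :=
  backwardMap γ g fs (q.1, q.2 - γ • couplingMap K q)

omit [NormedAddCommGroup P] [NormedSpace ℝ P] [FiniteDimensional ℝ P] in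
theorem norm_toLp_forwardBackward_sub_le {g : P → X → EReal} {fs : P → Y → EReal}
    {K : P → X →L[ℝ] Y} {α β γ : ℝ}
    (hα : 0 ≤ α) (hγ : 0 < γ) {θ : P} (hg : IsClosedProperConvex α (g θ))
    (hfs : IsClosedProperConvex α (fs θ)) (hK : ‖K θ‖ ≤ β) (z z' : X × Y) :
    ‖WithLp.toLp 2 (forwardBackward γ g fs K (θ, z) - forwardBackward γ g fs K (θ, z'))‖ ≤
      (1 + γ * α)⁻¹ * √(1 + γ ^ 2 * β ^ 2) * ‖WithLp.toLp 2 (z - z')‖ := by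
  refine (norm_toLp_backwardMap_sub_le hα hγ hg hfs _ _).trans ?_
  rw [mul_assoc]
  refine mul_le_mul_of_nonneg_left ?_ (by positivity)
  refine le_trans (le_of_eq ?_) (norm_toLp_sub_coupling_le hK γ _)
  rw [couplingMap_eq, map_sub, smul_sub]
  congr 2
  abel

omit [NormedAddCommGroup P] [NormedSpace ℝ P] [FiniteDimensional ℝ P] in
theorem exists_forwardBackward_fixedPoint {g : P → X → EReal} {fs : P → Y → EReal}
    {K : P → X →L[ℝ] Y} {α β γ : ℝ} (hα : 0 < α) (hβ : 0 < β)
    (hγ : γ ∈ Set.Ioo 0 (2 * α / (α + β) ^ 2)) {θ : P} (hg : IsClosedProperConvex α (g θ))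
    (hfs : IsClosedProperConvex α (fs θ)) (hK : ‖K θ‖ ≤ β) :
    ∃ z, forwardBackward γ g fs K (θ, z) = z := by
  have hκ := contraction_factor_lt_one hα hβ hγ
  have hγ0 : 0 < γ := hγ.1
  set κ := (1 + γ * α)⁻¹ * √(1 + γ ^ 2 * β ^ 2) with hκdef
  have hκ0 : 0 ≤ κ := by positivity
  -- The contraction holds in the Euclidean norm; the skew cancellation is not visible in the sup
  -- norm of `X × Y`.
  let Φ : WithLp 2 (X × Y) → WithLp 2 (X × Y) := fun z =>
    WithLp.toLp 2 (forwardBackward γ g fs K (θ, WithLp.ofLp z))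
  have hΦ : ContractingWith κ.toNNReal Φ := by
    refine ⟨by simpa using hκ, LipschitzWith.of_dist_le_mul fun z z' => ?_⟩
    rw [Real.coe_toNNReal _ hκ0, dist_eq_norm, dist_eq_norm]
    exact norm_toLp_forwardBackward_sub_le hα.le hγ0 hg hfs hK (WithLp.ofLp z) (WithLp.ofLp z')
  refine ⟨WithLp.ofLp hΦ.fixedPoint, ?_⟩
  exact congrArg WithLp.ofLp hΦ.fixedPoint_isFixedPt

-- The proximal optimality condition at a fixed point reads `γ⁻¹ ((z - γ B z) - z) = -B z`,
-- independent of `γ`.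
omit [NormedAddCommGroup P] [NormedSpace ℝ P] [FiniteDimensional ℝ P] in
theorem isSubgradient_of_forwardBackward_eq {g : P → X → EReal} {fs : P → Y → EReal}
    {K : P → X →L[ℝ] Y} {α γ : ℝ} (hα : 0 ≤ α) (hγ : 0 < γ) {θ : P}
    (hg : IsClosedProperConvex α (g θ)) (hfs : IsClosedProperConvex α (fs θ)) {z : X × Y}
    (hz : forwardBackward γ g fs K (θ, z) = z) :
    IsSubgradient (g θ) z.1 (-ContinuousLinearMap.adjoint (K θ) z.2) ∧
      IsSubgradient (fs θ) z.2 (K θ z.1) := by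
  constructor
  · have h1 := (proxMap_eq_iff hα hγ hg).1 (congrArg Prod.fst hz)
    have h2 : γ⁻¹ • ((z - γ • couplingMap K (θ, z)).1 - z.1) =
        -ContinuousLinearMap.adjoint (K θ) z.2 := by
      simp [couplingMap, hγ.ne']
    rwa [← h2]
  · have h1 := (proxMap_eq_iff hα hγ hfs).1 (congrArg Prod.snd hz)
    have h2 : γ⁻¹ • ((z - γ • couplingMap K (θ, z)).2 - z.2) = K θ z.1 := by
      simp [couplingMap, hγ.ne']
    rwa [← h2]

/-! ### Conservative Jacobians of the solution map -/

omit [FiniteDimensional ℝ X] [FiniteDimensional ℝ Y]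
  [FiniteDimensional ℝ P] [CompleteSpace X] [CompleteSpace Y] in
theorem backwardMap_locallyLipschitzOn {Θ : Set P} {g : P → X → EReal} {fs : P → Y → EReal}
    {γ : ℝ} (hg : LocallyLipschitzOn (Θ ×ˢ (Set.univ : Set X)) (proxMap γ g))
    (hfs : LocallyLipschitzOn (Θ ×ˢ (Set.univ : Set Y)) (proxMap γ fs)) :
    LocallyLipschitzOn (Θ ×ˢ (Set.univ : Set (X × Y))) (backwardMap γ g fs) := by
  have h1 : LocallyLipschitz fun q : P × (X × Y) => (q.1, q.2.1) :=
    (by fun_prop : ContDiff ℝ 1 fun q : P × (X × Y) => (q.1, q.2.1)).locallyLipschitz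
  have h2 : LocallyLipschitz fun q : P × (X × Y) => (q.1, q.2.2) :=
    (by fun_prop : ContDiff ℝ 1 fun q : P × (X × Y) => (q.1, q.2.2)).locallyLipschitz
  exact (hg.comp_of_mapsTo h1.locallyLipschitzOn fun q hq => ⟨hq.1, Set.mem_univ _⟩).prodMk
    (hfs.comp_of_mapsTo h2.locallyLipschitzOn fun q hq => ⟨hq.1, Set.mem_univ _⟩)

/-- The projection `(θ, (x, y)) ↦ (θ, x)`. -/
def primalProj (P X Y : Type*) [NormedAddCommGroup P] [NormedSpace ℝ P]
    [NormedAddCommGroup X] [NormedSpace ℝ X] [NormedAddCommGroup Y] [NormedSpace ℝ Y] :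
    P × (X × Y) →L[ℝ] P × X :=
  (ContinuousLinearMap.fst ℝ P (X × Y)).prod
    (ContinuousLinearMap.fst ℝ X Y ∘L ContinuousLinearMap.snd ℝ P (X × Y))

/-- The projection `(θ, (x, y)) ↦ (θ, y)`. -/
def dualProj (P X Y : Type*) [NormedAddCommGroup P] [NormedSpace ℝ P]
    [NormedAddCommGroup X] [NormedSpace ℝ X] [NormedAddCommGroup Y] [NormedSpace ℝ Y] :
    P × (X × Y) →L[ℝ] P × Y :=
  (ContinuousLinearMap.fst ℝ P (X × Y)).prod
    (ContinuousLinearMap.snd ℝ X Y ∘L ContinuousLinearMap.snd ℝ P (X × Y))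

/-- The block Jacobians of `T`, with independent Clarke Jacobians of the two proximal maps. -/
def backwardBlockJacobian (γ : ℝ) (g : P → X → EReal) (fs : P → Y → EReal) (q : P × (X × Y)) :
    Set (P × (X × Y) →L[ℝ] X × Y) :=
  {D | ∃ M ∈ clarkeJacobian (proxMap γ g) (primalProj P X Y q),
    ∃ N ∈ clarkeJacobian (proxMap γ fs) (dualProj P X Y q),
      D = (M ∘L primalProj P X Y).prod (N ∘L dualProj P X Y)}

omit [CompleteSpace X] [CompleteSpace Y] in
theorem isConservativeJacobianOn_backwardBlockJacobian {Θ : Set P} (hΘ : IsOpen Θ)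
    {g : P → X → EReal} {fs : P → Y → EReal}
    {γ : ℝ} (hg : PathDifferentiableOn (Θ ×ˢ (Set.univ : Set X)) (proxMap γ g))
    (hfs : PathDifferentiableOn (Θ ×ˢ (Set.univ : Set Y)) (proxMap γ fs)) :
    IsConservativeJacobianOn (Θ ×ˢ (Set.univ : Set (X × Y))) (backwardMap γ g fs)
      (backwardBlockJacobian γ g fs) := by
  have m₁ : Set.MapsTo (primalProj P X Y) (Θ ×ˢ (Set.univ : Set (X × Y)))
      (Θ ×ˢ (Set.univ : Set X)) := fun _ hq => ⟨hq.1, Set.mem_univ _⟩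
  have m₂ : Set.MapsTo (dualProj P X Y) (Θ ×ˢ (Set.univ : Set (X × Y)))
      (Θ ×ˢ (Set.univ : Set Y)) := fun _ hq => ⟨hq.1, Set.mem_univ _⟩
  exact (hg.isConservativeJacobianOn_clarkeJacobian (hΘ.prod isOpen_univ)).prodMap_clm
    (hfs.isConservativeJacobianOn_clarkeJacobian (hΘ.prod isOpen_univ)) _ _ m₁ m₂

omit [FiniteDimensional ℝ P] [CompleteSpace X] in
theorem norm_clarkeJacobian_proxMap_apply_inr_le {Θ : Set P} (hΘ : IsOpen Θ)
    {h : P → X → EReal} {α γ : ℝ} (hα : 0 ≤ α) (hγ : 0 < γ)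
    (H : ∀ θ ∈ Θ, IsClosedProperConvex α (h θ)) {q : P × X} (hq : q.1 ∈ Θ) {M : P × X →L[ℝ] X}
    (hM : M ∈ clarkeJacobian (proxMap γ h) q) (k : X) :
    ‖M (0, k)‖ ≤ (1 + γ * α)⁻¹ * ‖k‖ := by
  refine norm_clarkeJacobian_apply_inr_le hΘ (Λ := ContinuousLinearMap.fst ℝ X X)
    (r := fun k => (1 + γ * α)⁻¹ * ‖k‖) (fun k t ht => ?_) (fun θ hθ x k => ?_) hq hM k
  · rw [norm_smul, Real.norm_of_nonneg ht.le]
    ring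
  · simpa using norm_proxMap_sub_le hα hγ (H θ hθ) (x + k) x

omit [FiniteDimensional ℝ P] [CompleteSpace X] [CompleteSpace Y] in
theorem norm_toLp_backwardBlockJacobian_apply_inr_le {Θ : Set P} (hΘ : IsOpen Θ)
    {g : P → X → EReal} {fs : P → Y → EReal} {α γ : ℝ} (hα : 0 ≤ α) (hγ : 0 < γ)
    (hg : ∀ θ ∈ Θ, IsClosedProperConvex α (g θ)) (hfs : ∀ θ ∈ Θ, IsClosedProperConvex α (fs θ))
    {q : P × (X × Y)} (hq : q.1 ∈ Θ) {M : P × (X × Y) →L[ℝ] X × Y}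
    (hM : M ∈ backwardBlockJacobian γ g fs q) (k : X × Y) :
    ‖WithLp.toLp 2 (M (0, k))‖ ≤ (1 + γ * α)⁻¹ * ‖WithLp.toLp 2 k‖ := by
  obtain ⟨M₁, hM₁, M₂, hM₂, rfl⟩ := hM
  exact norm_toLp_le_of_components (by positivity)
    (norm_clarkeJacobian_proxMap_apply_inr_le hΘ hα hγ hg hq hM₁ k.1)
    (norm_clarkeJacobian_proxMap_apply_inr_le hΘ hα hγ hfs hq hM₂ k.2)

omit [FiniteDimensional ℝ P] [CompleteSpace X] [CompleteSpace Y] in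
theorem norm_toLp_clarkeJacobian_backwardMap_apply_inr_le {Θ : Set P} (hΘ : IsOpen Θ)
    {g : P → X → EReal} {fs : P → Y → EReal} {α γ : ℝ} (hα : 0 ≤ α) (hγ : 0 < γ)
    (hg : ∀ θ ∈ Θ, IsClosedProperConvex α (g θ)) (hfs : ∀ θ ∈ Θ, IsClosedProperConvex α (fs θ))
    {q : P × (X × Y)} (hq : q.1 ∈ Θ) {M : P × (X × Y) →L[ℝ] X × Y}
    (hM : M ∈ clarkeJacobian (backwardMap γ g fs) q) (k : X × Y) :
    ‖WithLp.toLp 2 (M (0, k))‖ ≤ (1 + γ * α)⁻¹ * ‖WithLp.toLp 2 k‖ := by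
  refine norm_clarkeJacobian_apply_inr_le hΘ
    (Λ := ((WithLp.prodContinuousLinearEquiv 2 ℝ X Y).symm : X × Y →L[ℝ] WithLp 2 (X × Y)) ∘L
      ContinuousLinearMap.fst ℝ (X × Y) (X × Y))
    (r := fun k => (1 + γ * α)⁻¹ * ‖WithLp.toLp 2 k‖) (fun k t ht => ?_) (fun θ hθ x k => ?_) hq hM k
  · rw [WithLp.toLp_smul, norm_smul, Real.norm_of_nonneg ht.le]
    ring
  · have := norm_toLp_backwardMap_sub_le hα hγ (hg θ hθ) (hfs θ hθ) (x + k) x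
    rw [add_sub_cancel_left] at this
    exact this

/-- The Jacobians of the residual `z - T(θ, z - γ B(θ, z))` obtained from the Jacobians `JT` of `T`
and the Clarke Jacobian of `B`. -/
def residualJacobian (γ : ℝ) (K : P → X →L[ℝ] Y)
    (JT : P × (X × Y) → Set (P × (X × Y) →L[ℝ] X × Y)) (q : P × (X × Y)) :
    Set (P × (X × Y) →L[ℝ] X × Y) :=
  {D | ∃ M ∈ JT (q.1, q.2 - γ • couplingMap K q), ∃ N ∈ clarkeJacobian (couplingMap K) q,
    D = ContinuousLinearMap.snd ℝ P (X × Y) - M ∘L (ContinuousLinearMap.fst ℝ P (X × Y)).prod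
      (ContinuousLinearMap.snd ℝ P (X × Y) - γ • N)}

omit [FiniteDimensional ℝ X] [FiniteDimensional ℝ Y]
  [FiniteDimensional ℝ P] in
theorem forwardMap_locallyLipschitzOn {Θ : Set P} {K : P → X →L[ℝ] Y} {γ : ℝ}
    (hB : LocallyLipschitzOn (Θ ×ˢ (Set.univ : Set (X × Y))) (couplingMap K)) :
    LocallyLipschitzOn (Θ ×ˢ (Set.univ : Set (X × Y)))
      fun q : P × (X × Y) => (q.1, q.2 - γ • couplingMap K q) := by
  have h1 : LocallyLipschitz fun p : (P × (X × Y)) × (X × Y) => (p.1.1, p.1.2 - γ • p.2) :=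
    (by fun_prop : ContDiff ℝ 1
      fun p : (P × (X × Y)) × (X × Y) => (p.1.1, p.1.2 - γ • p.2)).locallyLipschitz
  exact (h1.locallyLipschitzOn (s := Set.univ)).comp_of_mapsTo
    (LocallyLipschitz.id.locallyLipschitzOn.prodMk hB) (Set.mapsTo_univ _ _)

/-- `sub_comp` twice: the forward step is `id - (γ • inr) ∘ B`, and the residual is `snd` minus `T`
after the forward step. -/
theorem isConservativeJacobianOn_residualJacobian {Θ : Set P} (hΘ : IsOpen Θ)
    {K : P → X →L[ℝ] Y} (hK : PathDifferentiableOn Θ K) {γ : ℝ} {T : P × (X × Y) → X × Y}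
    {JT : P × (X × Y) → Set (P × (X × Y) →L[ℝ] X × Y)}
    (hT : IsConservativeJacobianOn (Θ ×ˢ (Set.univ : Set (X × Y))) T JT) :
    IsConservativeJacobianOn (Θ ×ˢ (Set.univ : Set (X × Y)))
      (fun q => q.2 - T (q.1, q.2 - γ • couplingMap K q)) (residualJacobian γ K JT) := by
  have hB := hK.couplingMap
  have hU : IsOpen (Θ ×ˢ (Set.univ : Set (X × Y))) := hΘ.prod isOpen_univ
  have h1 := ((γ • ContinuousLinearMap.inr ℝ P (X × Y)).isConservativeJacobianOn
    Set.univ).sub_comp (hB.isConservativeJacobianOn_clarkeJacobian hU) hB.1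
    (Set.mapsTo_univ _ _) (ContinuousLinearMap.id ℝ (P × (X × Y)))
  have h2 : (fun q : P × (X × Y) => ContinuousLinearMap.id ℝ (P × (X × Y)) q -
      (γ • ContinuousLinearMap.inr ℝ P (X × Y)) (couplingMap K q)) =
      fun q => (q.1, q.2 - γ • couplingMap K q) := by
    ext1 q
    ext1 <;> simp
  rw [h2] at h1
  refine (hT.sub_comp h1 (forwardMap_locallyLipschitzOn hB.1) (fun q hq => ⟨hq.1, Set.mem_univ _⟩)
    (ContinuousLinearMap.snd ℝ P (X × Y))).congr fun q _ => ?_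
  have h3 : ∀ N : P × (X × Y) →L[ℝ] X × Y, ContinuousLinearMap.id ℝ (P × (X × Y)) -
      (γ • ContinuousLinearMap.inr ℝ P (X × Y)) ∘L N =
      (ContinuousLinearMap.fst ℝ P (X × Y)).prod
        (ContinuousLinearMap.snd ℝ P (X × Y) - γ • N) := by
    intro N
    refine ContinuousLinearMap.ext fun v => ?_
    ext1 <;> simp
  ext D
  constructor
  · rintro ⟨M, hM, _, ⟨_, rfl, N, hN, rfl⟩, rfl⟩
    exact ⟨M, hM, N, hN, by rw [h3]⟩
  · rintro ⟨M, hM, N, hN, rfl⟩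
    exact ⟨M, hM, _, ⟨_, rfl, N, hN, rfl⟩, by rw [h3]⟩

-- The `z`-part of any Clarke Jacobian of `B` is `B` at the frozen parameter, so a kernel vector is
-- fixed by a linear map with the contraction factor of the forward-backward step.
omit [FiniteDimensional ℝ P] in
theorem isInvertible_partialSnd_residualJacobian {Θ : Set P} (hΘ : IsOpen Θ)
    {K : P → X →L[ℝ] Y} (hKc : ContinuousOn K Θ) {α β γ : ℝ} (hα : 0 < α) (hβ : 0 < β)
    (hγ : γ ∈ Set.Ioo 0 (2 * α / (α + β) ^ 2)) (hK : ∀ θ ∈ Θ, ‖K θ‖ ≤ β)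
    {JT : P × (X × Y) → Set (P × (X × Y) →L[ℝ] X × Y)}
    (hJT : ∀ θ ∈ Θ, ∀ z, ∀ M ∈ JT (θ, z), ∀ k : X × Y,
      ‖WithLp.toLp 2 (M (0, k))‖ ≤ (1 + γ * α)⁻¹ * ‖WithLp.toLp 2 k‖)
    {q : P × (X × Y)} (hq : q.1 ∈ Θ) {D : P × (X × Y) →L[ℝ] X × Y}
    (hD : D ∈ residualJacobian γ K JT q) : (partialSnd D).IsInvertible := by
  obtain ⟨M, hM, N, hN, rfl⟩ := hD
  have hγ0 : 0 < γ := hγ.1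
  refine ContinuousLinearMap.isInvertible_of_injective _ fun k hk => ?_
  have h1 : k = M (0, k - γ • couplingBilinear X Y (K q.1) k) := by
    rw [← sub_eq_zero, ← hk]
    simp [partialSnd, clarkeJacobian_couplingMap_apply_inr hΘ hKc hq hN]
  have h2 : ‖WithLp.toLp 2 k‖ ≤
      (1 + γ * α)⁻¹ * √(1 + γ ^ 2 * β ^ 2) * ‖WithLp.toLp 2 k‖ := by
    calc ‖WithLp.toLp 2 k‖ = ‖WithLp.toLp 2 (M (0, k - γ • couplingBilinear X Y (K q.1) k))‖ := by
          rw [← h1]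
      _ ≤ _ := hJT _ hq _ M hM _
      _ ≤ (1 + γ * α)⁻¹ * (√(1 + γ ^ 2 * β ^ 2) * ‖WithLp.toLp 2 k‖) := by
          refine mul_le_mul_of_nonneg_left (norm_toLp_sub_coupling_le (hK _ hq) γ k) (by positivity)
      _ = _ := by ring
  have h3 := eq_zero_of_norm_le_mul (contraction_factor_lt_one hα hβ hγ) h2
  exact congrArg WithLp.ofLp h3

omit [FiniteDimensional ℝ X] [FiniteDimensional ℝ Y]
  [FiniteDimensional ℝ P] in
theorem resJacobian_eq_residualJacobian (γ : ℝ) (K : P → X →L[ℝ] Y) (T : P × (X × Y) → X × Y)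
    (q : P × (X × Y)) :
    resJacobian γ T (couplingMap K) q = residualJacobian γ K (clarkeJacobian T) q := by
  have key : ∀ M N : P × (X × Y) →L[ℝ] X × Y,
      (γ • ((M ∘L ContinuousLinearMap.inr ℝ P (X × Y)) ∘L (N ∘L ContinuousLinearMap.inl ℝ P (X × Y)))
        - M ∘L ContinuousLinearMap.inl ℝ P (X × Y)).coprod
      (ContinuousLinearMap.id ℝ (X × Y) - (M ∘L ContinuousLinearMap.inr ℝ P (X × Y)) ∘L
        (ContinuousLinearMap.id ℝ (X × Y) - γ • (N ∘L ContinuousLinearMap.inr ℝ P (X × Y)))) =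
      ContinuousLinearMap.snd ℝ P (X × Y) - M ∘L (ContinuousLinearMap.fst ℝ P (X × Y)).prod
        (ContinuousLinearMap.snd ℝ P (X × Y) - γ • N) := by
    intro M N
    refine ContinuousLinearMap.ext fun v => ?_
    obtain ⟨h, k⟩ := v
    have h1 : N (h, k) = N (h, 0) + N (0, k) := by rw [← map_add]; simp
    have h2 : ∀ a, M (h, a) = M (h, 0) + M (0, a) := fun a => by rw [← map_add]; simp
    have h3 : ∀ a b, M (0, a + b) = M (0, a) + M (0, b) := fun a b => by rw [← map_add]; simp
    have h4 : ∀ a b, M (0, a - b) = M (0, a) - M (0, b) := fun a b => by rw [← map_sub]; simp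
    have h5 : ∀ a, M (0, γ • a) = γ • M (0, a) := fun a => by rw [← map_smul]; simp
    simp [h1, h2 (k - _), h3, h4, h5]
    abel
  ext D
  simp only [resJacobian, residualJacobian, Set.mem_ofPred_eq, key]

-- The block form writes `K` explicitly where the residual formula has the `z`-part of `N`; the two
-- agree because that part is determined by `K`.
omit [FiniteDimensional ℝ P] in
theorem resJacobianBlock_eq_residualJacobian {Θ : Set P} (hΘ : IsOpen Θ) (γ : ℝ)
    (g : P → X → EReal) (fs : P → Y → EReal) {K : P → X →L[ℝ] Y} (hKc : ContinuousOn K Θ)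
    {q : P × (X × Y)} (hq : q.1 ∈ Θ) :
    resJacobianBlock γ g fs K q = residualJacobian γ K (backwardBlockJacobian γ g fs) q := by
  have hp : primalProj P X Y (q.1, q.2 - γ • couplingMap K q) =
      (q.1, q.2.1 - γ • ContinuousLinearMap.adjoint (K q.1) q.2.2) := rfl
  have hd : dualProj P X Y (q.1, q.2 - γ • couplingMap K q) =
      (q.1, q.2.2 + γ • K q.1 q.2.1) := by
    simp [dualProj, couplingMap]
  have key : ∀ (M₁ : P × X →L[ℝ] X) (M₂ : P × Y →L[ℝ] Y),
      ∀ N ∈ clarkeJacobian (couplingMap K) q,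
      ((γ • ((M₁ ∘L ContinuousLinearMap.inr ℝ P X) ∘L (ContinuousLinearMap.fst ℝ X Y ∘L
            (N ∘L ContinuousLinearMap.inl ℝ P (X × Y)))) -
          M₁ ∘L ContinuousLinearMap.inl ℝ P X).prod
        (γ • ((M₂ ∘L ContinuousLinearMap.inr ℝ P Y) ∘L (ContinuousLinearMap.snd ℝ X Y ∘L
            (N ∘L ContinuousLinearMap.inl ℝ P (X × Y)))) -
          M₂ ∘L ContinuousLinearMap.inl ℝ P Y)).coprod
      (((ContinuousLinearMap.id ℝ X - M₁ ∘L ContinuousLinearMap.inr ℝ P X).coprod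
          (-((M₁ ∘L ContinuousLinearMap.inr ℝ P X) ∘L
            (-(γ • ContinuousLinearMap.adjoint (K q.1)))))).prod
        ((-((M₂ ∘L ContinuousLinearMap.inr ℝ P Y) ∘L (γ • K q.1))).coprod
          (ContinuousLinearMap.id ℝ Y - M₂ ∘L ContinuousLinearMap.inr ℝ P Y))) =
      ContinuousLinearMap.snd ℝ P (X × Y) -
        ((M₁ ∘L primalProj P X Y).prod (M₂ ∘L dualProj P X Y)) ∘L
          (ContinuousLinearMap.fst ℝ P (X × Y)).prod
            (ContinuousLinearMap.snd ℝ P (X × Y) - γ • N) := by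
    intro M₁ M₂ N hN
    refine ContinuousLinearMap.ext fun v => ?_
    obtain ⟨h, k⟩ := v
    have h1 : N (h, k) = N (h, 0) + couplingBilinear X Y (K q.1) k := by
      rw [← clarkeJacobian_couplingMap_apply_inr hΘ hKc hq hN k, ← map_add]
      simp
    have a2 : ∀ a, M₁ (h, a) = M₁ (h, 0) + M₁ (0, a) := fun a => by rw [← map_add]; simp
    have a3 : ∀ a b, M₁ (0, a + b) = M₁ (0, a) + M₁ (0, b) := fun a b => by
      rw [← map_add]; simp
    have a4 : ∀ a b, M₁ (0, a - b) = M₁ (0, a) - M₁ (0, b) := fun a b => by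
      rw [← map_sub]; simp
    have a5 : ∀ a, M₁ (0, γ • a) = γ • M₁ (0, a) := fun a => by rw [← map_smul]; simp
    have b2 : ∀ a, M₂ (h, a) = M₂ (h, 0) + M₂ (0, a) := fun a => by rw [← map_add]; simp
    have b3 : ∀ a b, M₂ (0, a + b) = M₂ (0, a) + M₂ (0, b) := fun a b => by
      rw [← map_add]; simp
    have b4 : ∀ a b, M₂ (0, a - b) = M₂ (0, a) - M₂ (0, b) := fun a b => by
      rw [← map_sub]; simp
    have b5 : ∀ a, M₂ (0, γ • a) = γ • M₂ (0, a) := fun a => by rw [← map_smul]; simp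
    have b6 : ∀ a, M₂ (0, -a) = -M₂ (0, a) := fun a => by rw [← map_neg]; simp
    ext1
    · simp [primalProj, h1, couplingBilinear_apply, a2 (_ - _), a3, a4, a5]
      abel
    · simp [dualProj, h1, couplingBilinear_apply, b2 (_ - _), b3, b4, b5, b6]
      abel
  ext D
  constructor
  · rintro ⟨M₁, hM₁, M₂, hM₂, N, hN, rfl⟩
    refine ⟨_, ⟨M₁, hp ▸ hM₁, M₂, hd ▸ hM₂, rfl⟩, N, hN, key M₁ M₂ N hN⟩
  · rintro ⟨_, ⟨M₁, hM₁, M₂, hM₂, rfl⟩, N, hN, rfl⟩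
    exact ⟨M₁, hp ▸ hM₁, M₂, hd ▸ hM₂, N, hN, (key M₁ M₂ N hN).symm⟩

theorem locallyLipschitzOn_fixedPoint {Θ : Set P} {K : P → X →L[ℝ] Y}
    (hKp : PathDifferentiableOn Θ K) {α β γ : ℝ} (hα : 0 < α) (hβ : 0 < β)
    (hγ : γ ∈ Set.Ioo 0 (2 * α / (α + β) ^ 2)) (hK : ∀ θ ∈ Θ, ‖K θ‖ ≤ β)
    {g : P → X → EReal} {fs : P → Y → EReal}
    (hg : ∀ θ ∈ Θ, IsClosedProperConvex α (g θ)) (hfs : ∀ θ ∈ Θ, IsClosedProperConvex α (fs θ))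
    (hT : LocallyLipschitzOn (Θ ×ˢ (Set.univ : Set (X × Y))) (backwardMap γ g fs))
    {z : P → X × Y} (hz : ∀ θ ∈ Θ, forwardBackward γ g fs K (θ, z θ) = z θ) :
    LocallyLipschitzOn Θ z := by
  have hκ := contraction_factor_lt_one hα hβ hγ
  have hγ0 : 0 < γ := hγ.1
  set κ := (1 + γ * α)⁻¹ * √(1 + γ ^ 2 * β ^ 2) with hκdef
  have hΦ : LocallyLipschitzOn (Θ ×ˢ (Set.univ : Set (X × Y))) (forwardBackward γ g fs K) :=
    hT.comp_of_mapsTo (forwardMap_locallyLipschitzOn hKp.couplingMap.1)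
      fun q hq => ⟨hq.1, Set.mem_univ _⟩
  have hR : LocallyLipschitzOn (Θ ×ˢ (Set.univ : Set (X × Y)))
      fun q => q.2 - forwardBackward γ g fs K q :=
    LipschitzWith.prod_snd.locallyLipschitz.locallyLipschitzOn.sub hΦ
  let e := (WithLp.prodContinuousLinearEquiv 2 ℝ X Y)
  let A : X × Y →L[ℝ] WithLp 2 (X × Y) := e.symm
  let B : WithLp 2 (X × Y) →L[ℝ] X × Y := e
  -- `(1 - κ)⁻¹` bounds the inverse of the residual in the Euclidean norm; `‖A‖` and `‖B‖` pass
  -- between that norm and the product norm.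
  have hC : 0 ≤ ‖B‖ * ((1 - κ)⁻¹ * ‖A‖) := by
    have : 0 ≤ (1 - κ)⁻¹ := inv_nonneg.2 (by linarith)
    positivity
  refine locallyLipschitzOn_of_implicit hR (C := (‖B‖ * ((1 - κ)⁻¹ * ‖A‖)).toNNReal) ?_
    fun θ hθ => by simp [hz θ hθ]
  intro θ hθ w w'
  rw [dist_eq_norm, dist_eq_norm, Real.coe_toNNReal _ hC]
  set d := w - w' with hd
  set r := w - forwardBackward γ g fs K (θ, w) - (w' - forwardBackward γ g fs K (θ, w')) with hr
  have h1 := norm_toLp_forwardBackward_sub_le hα.le hγ0 (hg θ hθ) (hfs θ hθ) (hK θ hθ) w w'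
  have h2 : WithLp.toLp 2 (forwardBackward γ g fs K (θ, w) - forwardBackward γ g fs K (θ, w')) =
      WithLp.toLp 2 d - WithLp.toLp 2 r := by
    rw [← WithLp.toLp_sub]
    congr 1
    rw [hd, hr]
    abel
  rw [h2] at h1
  have h3 : ‖WithLp.toLp 2 d‖ ≤ (1 - κ)⁻¹ * ‖WithLp.toLp 2 r‖ := by
    rw [le_inv_mul_iff₀ (by linarith)]
    have := norm_sub_norm_le (WithLp.toLp 2 d) (WithLp.toLp 2 r)
    linarith
  have h4 : ‖d‖ ≤ ‖B‖ * ‖WithLp.toLp 2 d‖ := B.le_opNorm (WithLp.toLp 2 d)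
  have h5 : ‖WithLp.toLp 2 r‖ ≤ ‖A‖ * ‖r‖ := A.le_opNorm r
  have h6 : 0 ≤ (1 - κ)⁻¹ := inv_nonneg.2 (by linarith)
  calc ‖d‖ ≤ ‖B‖ * ‖WithLp.toLp 2 d‖ := h4
    _ ≤ ‖B‖ * ((1 - κ)⁻¹ * (‖A‖ * ‖r‖)) := by gcongr; exact h3.trans (by gcongr)
    _ = _ := by ring

/-- Stated for any conservative Jacobian of `T` with the contraction bound, so that the block and
the joint Clarke versions are both instances. -/
theorem isConservativeJacobianOn_solution {Θ : Set P} (hΘ : IsOpen Θ)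
    {K : P → X →L[ℝ] Y} (hKp : PathDifferentiableOn Θ K) {α β γ : ℝ} (hα : 0 < α) (hβ : 0 < β)
    (hγ : γ ∈ Set.Ioo 0 (2 * α / (α + β) ^ 2)) (hK : ∀ θ ∈ Θ, ‖K θ‖ ≤ β)
    {T : P × (X × Y) → X × Y} {JT : P × (X × Y) → Set (P × (X × Y) →L[ℝ] X × Y)}
    (hT : IsConservativeJacobianOn (Θ ×ˢ (Set.univ : Set (X × Y))) T JT)
    (hJT : ∀ θ ∈ Θ, ∀ z, ∀ M ∈ JT (θ, z), ∀ k : X × Y,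
      ‖WithLp.toLp 2 (M (0, k))‖ ≤ (1 + γ * α)⁻¹ * ‖WithLp.toLp 2 k‖)
    {z : P → X × Y} (hlip : LocallyLipschitzOn Θ z)
    (hz : ∀ θ ∈ Θ, T (θ, z θ - γ • couplingMap K (θ, z θ)) = z θ)
    {J : P × (X × Y) → Set (P × (X × Y) →L[ℝ] X × Y)}
    (hJ : ∀ q : P × (X × Y), q.1 ∈ Θ → J q = residualJacobian γ K JT q) :
    (∀ θ ∈ Θ, ∀ D ∈ J (θ, z θ), (partialSnd D).IsInvertible) ∧
      IsConservativeJacobianOn Θ z fun θ => implicitJacobian (J (θ, z θ)) := by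
  have hinv : ∀ θ ∈ Θ, ∀ D ∈ J (θ, z θ), (partialSnd D).IsInvertible := fun θ hθ D hD =>
    isInvertible_partialSnd_residualJacobian hΘ hKp.1.continuousOn hα hβ hγ hK hJT
      (q := (θ, z θ)) hθ (hJ (θ, z θ) hθ ▸ hD)
  refine ⟨hinv, ?_⟩
  have h1 := (isConservativeJacobianOn_residualJacobian hΘ hKp (γ := γ) hT).congr
    fun q hq => (hJ q hq.1).symm
  exact h1.implicit hlip (fun θ hθ => by simp [hz θ hθ]) hinv

end

end

/-! ### The main theorem. -/

theorem theorem5p4 (p n m : ℕ)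
    (Θ : Set (EuclideanSpace ℝ (Fin p))) (hΘ_open : IsOpen Θ) (hΘ_conn : IsConnected Θ)
    (g : EuclideanSpace ℝ (Fin p) → EuclideanSpace ℝ (Fin n) → EReal)
    (f : EuclideanSpace ℝ (Fin p) → EuclideanSpace ℝ (Fin m) → EReal)
    (K : EuclideanSpace ℝ (Fin p) → EuclideanSpace ℝ (Fin n) →L[ℝ] EuclideanSpace ℝ (Fin m))
    (α β γ : ℝ) (hα : 0 < α) (hβ : 0 < β)
    -- `g_θ` is closed, proper and `α`-strongly convex
    (hg : ∀ θ ∈ Θ, LowerSemicontinuous (g θ) ∧ ProperFun (g θ) ∧ StronglyConvexFun α (g θ))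
    -- `f_θ` is closed, proper and convex, and its conjugate is `α`-strongly convex
    (hf : ∀ θ ∈ Θ, LowerSemicontinuous (f θ) ∧ ProperFun (f θ) ∧ StronglyConvexFun 0 (f θ))
    (hfs : ∀ θ ∈ Θ, StronglyConvexFun α (fenchelConj (f θ)))
    (hK : ∀ θ ∈ Θ, ‖K θ‖ ≤ β)
    -- path differentiability of `(θ, x) ↦ prox_{g_θ}(x)`, of `(θ, y) ↦ prox_{f_θ}(y)` and of `K`
    (hg_path : PathDifferentiableOn (Θ ×ˢ Set.univ)
      (fun q : EuclideanSpace ℝ (Fin p) × EuclideanSpace ℝ (Fin n) => prox (g q.1) q.2))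
    (hf_path : PathDifferentiableOn (Θ ×ˢ Set.univ)
      (fun q : EuclideanSpace ℝ (Fin p) × EuclideanSpace ℝ (Fin m) => prox (f q.1) q.2))
    (hK_path : PathDifferentiableOn Θ K)
    (hγ : γ ∈ Set.Ioo 0 (2 * α / (α + β) ^ 2)) :
    (∀ θ ∈ Θ, ∃! z : EuclideanSpace ℝ (Fin n) × EuclideanSpace ℝ (Fin m),
      IsMinMaxSolution (g θ) (fenchelConj (f θ)) (K θ) z) ∧
    ∀ z : EuclideanSpace ℝ (Fin p) → EuclideanSpace ℝ (Fin n) × EuclideanSpace ℝ (Fin m),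
      (∀ θ ∈ Θ, IsMinMaxSolution (g θ) (fenchelConj (f θ)) (K θ) (z θ)) →
      PathDifferentiableOn Θ z ∧
      -- the block conservative Jacobian
      (∀ θ ∈ Θ, ∀ D ∈ resJacobianBlock γ g (fun τ => fenchelConj (f τ)) K (θ, z θ),
        (partialSnd D).IsInvertible) ∧
      IsConservativeJacobianOn Θ z (fun θ => implicitJacobian
        (resJacobianBlock γ g (fun τ => fenchelConj (f τ)) K (θ, z θ))) ∧
      -- its variant with the joint Clarke Jacobian of the pair of proximal maps
      (∀ θ ∈ Θ, ∀ D ∈ resJacobian γ (backwardMap γ g (fun τ => fenchelConj (f τ)))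
          (couplingMap K) (θ, z θ), (partialSnd D).IsInvertible) ∧
      IsConservativeJacobianOn Θ z (fun θ => implicitJacobian
        (resJacobian γ (backwardMap γ g (fun τ => fenchelConj (f τ)))
          (couplingMap K) (θ, z θ))) := by
  set fs : EuclideanSpace ℝ (Fin p) → EuclideanSpace ℝ (Fin m) → EReal :=
    fun τ => fenchelConj (f τ) with hfsdef
  have hγ0 : 0 < γ := hγ.1
  have Hg : ∀ θ ∈ Θ, IsClosedProperConvex α (g θ) := fun θ hθ =>
    ⟨(hg θ hθ).1, (hg θ hθ).2.1, (hg θ hθ).2.2⟩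
  have Hf : ∀ θ ∈ Θ, IsClosedProperConvex 0 (f θ) := fun θ hθ =>
    ⟨(hf θ hθ).1, (hf θ hθ).2.1, (hf θ hθ).2.2⟩
  have Hfs : ∀ θ ∈ Θ, IsClosedProperConvex α (fs θ) := fun θ hθ =>
    (Hf θ hθ).fenchelConj le_rfl (hfs θ hθ)
  have huniq : ∀ θ ∈ Θ, ∃ w, forwardBackward γ g fs K (θ, w) = w ∧
      IsMinMaxSolution (g θ) (fs θ) (K θ) w ∧
      ∀ w', IsMinMaxSolution (g θ) (fs θ) (K θ) w' → w' = w := by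
    intro θ hθ
    obtain ⟨w, hw⟩ := exists_forwardBackward_fixedPoint hα hβ hγ (Hg θ hθ) (Hfs θ hθ) (hK θ hθ)
    obtain ⟨h1, h2⟩ := isSubgradient_of_forwardBackward_eq hα.le hγ0 (Hg θ hθ) (Hfs θ hθ) hw
    exact ⟨w, hw, isMinMaxSolution_of_isSubgradient h1 h2, fun w' hw' =>
      hw'.eq_of_isSubgradient hα hα (Hg θ hθ).convex (Hfs θ hθ).convex h1 h2⟩
  refine ⟨fun θ hθ => ?_, fun z hz => ?_⟩
  · obtain ⟨w, -, h1, h2⟩ := huniq θ hθ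
    exact ⟨w, h1, h2⟩
  -- Any solution map satisfies the fixed point equation, since the only solution is the Banach
  -- fixed point.
  have hfix : ∀ θ ∈ Θ, forwardBackward γ g fs K (θ, z θ) = z θ := by
    intro θ hθ
    obtain ⟨w, hw, -, h2⟩ := huniq θ hθ
    rwa [h2 _ (hz θ hθ)]
  have hPg := hg_path.proxMap hΘ_open hα.le hγ0 Hg
  have hfs_path : PathDifferentiableOn (Θ ×ˢ Set.univ)
      (fun q : EuclideanSpace ℝ (Fin p) × EuclideanSpace ℝ (Fin m) => prox (fs q.1) q.2) := by
    refine (hf_path.clm_sub (hΘ_open.prod isOpen_univ) (ContinuousLinearMap.snd ℝ _ _)).congr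
      fun q hq => ?_
    exact ((Hf q.1 hq.1).prox_fenchelConj le_rfl hα.le (hfs q.1 hq.1) q.2).symm
  have hPfs := hfs_path.proxMap hΘ_open hα.le hγ0 Hfs
  have hTblock := isConservativeJacobianOn_backwardBlockJacobian hΘ_open hPg hPfs
  have hTlip := backwardMap_locallyLipschitzOn hPg.1 hPfs.1
  -- The block Jacobian certifies that `T` is path differentiable, which makes its joint Clarke
  -- Jacobian conservative too.
  have hTclarke := PathDifferentiableOn.isConservativeJacobianOn_clarkeJacobian
    (hΘ_open.prod isOpen_univ) ⟨hTlip, _, hTblock⟩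
  have hlip : LocallyLipschitzOn Θ z :=
    locallyLipschitzOn_fixedPoint hK_path hα hβ hγ hK Hg Hfs hTlip hfix
  obtain ⟨h1, h2⟩ := isConservativeJacobianOn_solution hΘ_open hK_path hα hβ hγ hK hTblock
    (fun θ hθ w _ hM k => norm_toLp_backwardBlockJacobian_apply_inr_le hΘ_open hα.le hγ0 Hg Hfs
      (q := (θ, w)) hθ hM k) hlip hfix fun q hq =>
      resJacobianBlock_eq_residualJacobian hΘ_open γ g fs hK_path.1.continuousOn hq
  obtain ⟨h3, h4⟩ := isConservativeJacobianOn_solution hΘ_open hK_path hα hβ hγ hK hTclarke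
    (fun θ hθ w _ hM k => norm_toLp_clarkeJacobian_backwardMap_apply_inr_le hΘ_open hα.le hγ0 Hg
      Hfs (q := (θ, w)) hθ hM k) hlip hfix fun q _ => resJacobian_eq_residualJacobian γ K _ q
  exact ⟨⟨hlip, _, h2⟩, h1, h2, h3, h4⟩
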